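/- Let $M$ be a compact smooth manifold of real dimension $4n$ with a hypercomplex structure $(I,J,K)$, i.e. a triple of (integrable) complex structures, acting on tangent vectors from the right, with $IJ=-JI=K$. Quaternions act on 1-forms by $(q\alpha)(X)=\alpha(X\circ q)$, and $J$ acts multiplicatively on forms. Let $\Lambda^{p,q}_I(M)$ be the complex-valued $(p,q)$-forms with respect to $I$ (so $\alpha(X\circ I)=\sqrt{-1}\,\alpha(X)$ for a $(1,0)$-form $\alpha$), $\partial,\bar\partial$ the Dolbeault operators of $(M,I)$, and $\partial_J=J^{-1}\circ\bar\partial\circ J:\Lambda^{p,0}_I(M)\to\Lambda^{p+1,0}_I(M)$. A form $\eta\in\Lambda^{2,0}_I(M)$ is q-real if $\eta(X,Y)=\overline{\eta(X\circ J,Y\circ J)}$ for all $X,Y$; a q-real $(2,0)$-form is q-positive if $\eta(X,X\circ J)\ge 0$ for all real tangent vectors $X$. A $2$-form $\Omega$ is an HKT-form if there is a smooth Riemannian metric $g$ on $M$, invariant under the group $SU(2)$ of unit quaternions, such that $\Omega=-\omega_J+\sqrt{-1}\,\omega_K$, where $\omega_L(A,B)=g(A,B\circ L)$, and if $\partial\Omega=0$;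 such an $\Omega$ is of type $(2,0)$. Let $\Omega$ be an HKT-form on $M$, and let $f,\varphi:M\to\mathbb R$ be $C^\infty$ functions satisfying the quaternionic Monge-Ampère equation $$(\Omega+\partial\partial_J\varphi)^n=e^f\,\Omega^n .$$ Then at every point $x\in M$ the form $\Omega+\partial\partial_J\varphi$ belongs to the interior of the cone of q-positive $(2,0)$-forms at $x$ (the interior being taken in the real vector space of q-real $(2,0)$-forms at $x$). Moreover, $\Omega+\partial\partial_J\varphi$ is an HKT-form. -/

import Mathlib

open scoped Manifold ContDiff Topology

namespace HKT

noncomputable section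

/-! ## Linear algebra of complex-valued alternating forms on a real vector space -/

section Algebra

variable {V : Type*} [AddCommGroup V] [Module ℝ V]

/-- The wedge product of complex-valued alternating forms (sum over shuffles). -/
def wedge {p q : ℕ} (α : V [⋀^Fin p]→ₗ[ℝ] ℂ) (β : V [⋀^Fin q]→ₗ[ℝ] ℂ) :
    V [⋀^Fin (p + q)]→ₗ[ℝ] ℂ :=
  ((LinearMap.mul' ℝ ℂ).compAlternatingMap (α.domCoprod β)).domDomCongr finSumFinEquiv

/-- The `m`-th exterior power `η ∧ ⋯ ∧ η` of a 2-form `η`. -/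
def wedgePow (η : V [⋀^Fin 2]→ₗ[ℝ] ℂ) : (m : ℕ) → V [⋀^Fin (2 * m)]→ₗ[ℝ] ℂ
  | 0 => AlternatingMap.constOfIsEmpty ℝ V (Fin 0) (1 : ℂ)
  | m + 1 => wedge (wedgePow η m) η

variable [TopologicalSpace V]

/-- Auxiliary sum behind `holPart`. -/
def holPartAux (I : V →L[ℝ] V) {k : ℕ} (η : V [⋀^Fin k]→L[ℝ] ℂ) :
    ContinuousMultilinearMap ℝ (fun _ : Fin k => V) ℂ :=
  ((2 : ℂ)⁻¹ ^ k) • ∑ s : Finset (Fin k), ((-Complex.I) ^ s.card) •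
    η.toContinuousMultilinearMap.compContinuousLinearMap
      (fun i => if i ∈ s then I else ContinuousLinearMap.id ℝ V)

theorem holPartAux_apply (I : V →L[ℝ] V) {k : ℕ} (η : V [⋀^Fin k]→L[ℝ] ℂ) (v : Fin k → V) :
    holPartAux I η v = ((2 : ℂ)⁻¹ ^ k) * ∑ s : Finset (Fin k), ((-Complex.I) ^ s.card) *
      η (fun i => if i ∈ s then I (v i) else v i) := by
  simp only [holPartAux, _root_.smul_apply, _root_.sum_apply,
    smul_eq_mul, ContinuousMultilinearMap.compContinuousLinearMap_apply]
  congr 1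
  refine Finset.sum_congr rfl fun s _ => ?_
  congr 1
  change η _ = η _
  congr 1
  ext i
  by_cases h : i ∈ s <;> simp [h]

theorem holPartAux_eq_zero (I : V →L[ℝ] V) {k : ℕ} (η : V [⋀^Fin k]→L[ℝ] ℂ) (v : Fin k → V)
    (i j : Fin k) (hv : v i = v j) (hij : i ≠ j) : holPartAux I η v = 0 := by
  rw [holPartAux_apply]
  refine mul_eq_zero_of_right _ ?_
  have key : ∀ s : Finset (Fin k),
      (fun l => if l ∈ s.map (Equiv.swap i j).toEmbedding then I (v l) else v l) =
        (fun l => if l ∈ s then I (v l) else v l) ∘ Equiv.swap i j := by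
    intro s
    have hsw : ∀ l, v (Equiv.swap i j l) = v l := by
      intro l
      by_cases h1 : l = i
      · subst h1; simp [hv]
      · by_cases h2 : l = j
        · subst h2; simp [hv]
        · rw [Equiv.swap_apply_of_ne_of_ne h1 h2]
    ext l
    simp only [Function.comp_apply, hsw, Finset.mem_map_equiv, Equiv.symm_swap]
  have hneg : ∀ s : Finset (Fin k),
      η (fun l => if l ∈ s.map (Equiv.swap i j).toEmbedding then I (v l) else v l) =
        - η (fun l => if l ∈ s then I (v l) else v l) := by
    intro s
    rw [key s]
    exact η.toAlternatingMap.map_swap _ hij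
  refine Finset.sum_involution (fun s _ => s.map (Equiv.swap i j).toEmbedding) ?_ ?_ ?_ ?_
  · intro s _
    rw [hneg s, Finset.card_map]
    ring
  · intro s _ hne heq
    apply hne
    have h := hneg s
    rw [heq] at h
    rw [self_eq_neg.mp h, mul_zero]
  · intro s _; exact Finset.mem_univ _
  · intro s _
    ext l
    simp

/-- The `(k,0)`-part, with respect to the complex structure `I`, of a complex-valued `k`-form:
`η` is extended complex-multilinearly to `V ⊗ ℂ` and evaluated on the vectors
`X_i^{1,0} = (X_i - √-1 · X_i I) / 2`. Replacing `I` by `-I` gives the `(0,k)`-part. -/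
def holPart (I : V →L[ℝ] V) {k : ℕ} (η : V [⋀^Fin k]→L[ℝ] ℂ) : V [⋀^Fin k]→L[ℝ] ℂ :=
  { holPartAux I η with
    map_eq_zero_of_eq' := holPartAux_eq_zero I η }

/-- The real vector space of q-real `(2,0)`-forms: forms `η` of type `(2,0)` for `I`, that is
`η (X I, Y) = √-1 η (X, Y)`, which are fixed by the real structure `η ↦ J η̄`, where
`(J η̄) (X, Y) = conj (η (X J, Y J))`. -/
def qReal20 (I J : V →L[ℝ] V) : Submodule ℝ (V [⋀^Fin 2]→L[ℝ] ℂ) where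
  carrier := {η | (∀ X Y : V, η ![I X, Y] = Complex.I * η ![X, Y]) ∧
    ∀ X Y : V, (starRingEnd ℂ) (η ![J X, J Y]) = η ![X, Y]}
  zero_mem' := by simp
  add_mem' := by
    rintro a b ⟨ha, ha'⟩ ⟨hb, hb'⟩
    refine ⟨fun X Y => ?_, fun X Y => ?_⟩
    · simp only [ContinuousAlternatingMap.add_apply, ha, hb, mul_add]
    · simp only [ContinuousAlternatingMap.add_apply, map_add, ha', hb']
  smul_mem' := by
    rintro c a ⟨ha, ha'⟩
    refine ⟨fun X Y => ?_, fun X Y => ?_⟩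
    · simp only [ContinuousAlternatingMap.smul_apply, ha, mul_smul_comm]
    · simp only [ContinuousAlternatingMap.smul_apply, ← ha' X Y, Complex.real_smul, map_mul,
        Complex.conj_ofReal]

open ComplexOrder in
/-- The cone of q-positive `(2,0)`-forms, `η (X, X J) ≥ 0` for all real `X`, inside the real
vector space of q-real `(2,0)`-forms. -/
def qPositiveCone (I J : V →L[ℝ] V) : Set (qReal20 I J) :=
  {η | ∀ X : V, 0 ≤ (η : V [⋀^Fin 2]→L[ℝ] ℂ) ![X, J X]}

end Algebra

/-! ## Hypercomplex manifolds, differential forms and Dolbeault operators -/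

/-- The model space of manifolds of real dimension `4n`. -/
abbrev Model (n : ℕ) : Type := EuclideanSpace ℝ (Fin (4 * n))

section Manifold

variable (n : ℕ) (M : Type*) [TopologicalSpace M] [ChartedSpace (Model n) M]

/-- A field of endomorphisms of the tangent bundle. -/
abbrev EndField : Type _ :=
  (x : M) → TangentSpace 𝓘(ℝ, Model n) x →L[ℝ] TangentSpace 𝓘(ℝ, Model n) x

/-- Complex-valued differential `k`-forms (not necessarily smooth). -/
abbrev Form (k : ℕ) : Type _ :=
  (x : M) → TangentSpace 𝓘(ℝ, Model n) x [⋀^Fin k]→L[ℝ] ℂ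

variable {n M}

/-- `X ↦ A X` for a field of endomorphisms `A` and a vector field `X`. -/
def EndField.app (A : EndField n M) (X : (x : M) → TangentSpace 𝓘(ℝ, Model n) x) :
    (x : M) → TangentSpace 𝓘(ℝ, Model n) x :=
  fun x => A x (X x)

/-- The Nijenhuis tensor of `A` vanishes. -/
def EndField.NijenhuisZero [IsManifold 𝓘(ℝ, Model n) ∞ M] (A : EndField n M) : Prop :=
  ∀ (x : M) (X Y : (x : M) → TangentSpace 𝓘(ℝ, Model n) x),
    ContMDiffAt 𝓘(ℝ, Model n) 𝓘(ℝ, Model n).tangent ∞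
      (fun y => (⟨y, X y⟩ : TangentBundle 𝓘(ℝ, Model n) M)) x →
    ContMDiffAt 𝓘(ℝ, Model n) 𝓘(ℝ, Model n).tangent ∞
      (fun y => (⟨y, Y y⟩ : TangentBundle 𝓘(ℝ, Model n) M)) x →
    VectorField.mlieBracket 𝓘(ℝ, Model n) X Y x
      + A x (VectorField.mlieBracket 𝓘(ℝ, Model n) (A.app X) Y x)
      + A x (VectorField.mlieBracket 𝓘(ℝ, Model n) X (A.app Y) x)
      - VectorField.mlieBracket 𝓘(ℝ, Model n) (A.app X) (A.app Y) x = 0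

/-- A (smooth, integrable) complex structure on `M`, as a field of endomorphisms of the tangent
bundle. -/
structure IsComplexStructure [IsManifold 𝓘(ℝ, Model n) ∞ M] (A : EndField n M) : Prop where
  contMDiff : ContMDiff 𝓘(ℝ, Model n) (𝓘(ℝ, Model n).prod 𝓘(ℝ, Model n →L[ℝ] Model n)) ∞
    (fun x => Bundle.TotalSpace.mk' (Model n →L[ℝ] Model n)
      (E := fun x : M => TangentSpace 𝓘(ℝ, Model n) x →L[ℝ] TangentSpace 𝓘(ℝ, Model n) x) x (A x))
  sq : ∀ (x : M) (X : TangentSpace 𝓘(ℝ, Model n) x), A x (A x X) = -X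
  integrable : A.NijenhuisZero

variable (n M) in
/-- A hypercomplex structure. The complex structures act on the *right* on tangent vectors: the
map `I x` is `X ↦ X ∘ I`. Hence `X ∘ (IJ) = (X ∘ I) ∘ J` is `J x (I x X)`, and the
relations `IJ = -JI = K` read as stated in `relIJ` and `relJI`. -/
structure HypercomplexStructure [IsManifold 𝓘(ℝ, Model n) ∞ M] where
  I : EndField n M
  J : EndField n M
  K : EndField n M
  isComplex_I : IsComplexStructure I
  isComplex_J : IsComplexStructure J
  isComplex_K : IsComplexStructure K
  relIJ : ∀ (x : M) (X : TangentSpace 𝓘(ℝ, Model n) x), J x (I x X) = K x X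
  relJI : ∀ (x : M) (X : TangentSpace 𝓘(ℝ, Model n) x), -(I x (J x X)) = K x X

/-- The form `α` read in the chart around `x₀`. -/
def Form.inChart {k : ℕ} (α : Form n M k) (x₀ : M) (y : Model n) : Model n [⋀^Fin k]→L[ℝ] ℂ :=
  (α ((extChartAt 𝓘(ℝ, Model n) x₀).symm y)).compContinuousLinearMap
    (mfderiv 𝓘(ℝ, Model n) 𝓘(ℝ, Model n) (extChartAt 𝓘(ℝ, Model n) x₀).symm y)

/-- The exterior derivative, computed at `x` in the chart around `x`. -/
def Form.d {k : ℕ} (α : Form n M k) : Form n M (k + 1) := fun x =>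
  (extDeriv (Form.inChart α x) (extChartAt 𝓘(ℝ, Model n) x x)).compContinuousLinearMap
    (mfderiv 𝓘(ℝ, Model n) 𝓘(ℝ, Model n) (extChartAt 𝓘(ℝ, Model n) x) x)

variable (n) in
/-- A real function as a complex-valued `0`-form. -/
def ofFun (φ : M → ℝ) : Form n M 0 := fun x =>
  ContinuousAlternatingMap.constOfIsEmpty ℝ (TangentSpace 𝓘(ℝ, Model n) x) (Fin 0) (φ x : ℂ)

variable [IsManifold 𝓘(ℝ, Model n) ∞ M] (H : HypercomplexStructure n M)

/-- The Dolbeault operator `∂ : Λ^{p,0}_I → Λ^{p+1,0}_I`, the `(p+1,0)`-part of `d`. -/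
def del {p : ℕ} (α : Form n M p) : Form n M (p + 1) := fun x => holPart (H.I x) (Form.d α x)

/-- The Dolbeault operator `∂̄ : Λ^{0,p}_I → Λ^{0,p+1}_I`, the `(0,p+1)`-part of `d`. -/
def delbar {p : ℕ} (α : Form n M p) : Form n M (p + 1) := fun x => holPart (-H.I x) (Form.d α x)

/-- The action of `J` on forms, `(J α) (X₁, …) = α (X₁ J, …)`. -/
def actJ {p : ℕ} (α : Form n M p) : Form n M p := fun x => (α x).compContinuousLinearMap (H.J x)

/-- The inverse of the action of `J` on forms (note that `J⁻¹ = -J`). -/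
def actJinv {p : ℕ} (α : Form n M p) : Form n M p :=
  fun x => (α x).compContinuousLinearMap (-H.J x)

/-- `∂_J = J⁻¹ ∘ ∂̄ ∘ J : Λ^{p,0}_I → Λ^{p+1,0}_I`. -/
def delJ {p : ℕ} (α : Form n M p) : Form n M (p + 1) := actJinv H (delbar H (actJ H α))

/-- Smooth Riemannian metrics on `M`. -/
abbrev Metric (n : ℕ) (M : Type*) [TopologicalSpace M] [ChartedSpace (Model n) M]
    [IsManifold 𝓘(ℝ, Model n) ∞ M] : Type _ :=
  Bundle.ContMDiffRiemannianMetric 𝓘(ℝ, Model n) ∞ (Model n)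
    (fun x : M => TangentSpace 𝓘(ℝ, Model n) x)

/-- `g` is invariant under the group `SU(2)` of unitary quaternions. -/
def IsQuaternionicHermitian (g : Metric n M) : Prop :=
  ∀ a b c d : ℝ, a ^ 2 + b ^ 2 + c ^ 2 + d ^ 2 = 1 →
    ∀ (x : M) (X Y : TangentSpace 𝓘(ℝ, Model n) x),
      g.inner x (a • X + b • H.I x X + c • H.J x X + d • H.K x X)
        (a • Y + b • H.I x Y + c • H.J x Y + d • H.K x Y) = g.inner x X Y

/-- `Ω` is the form `-ω_J + √-1 ω_K` of the metric `g`, where `ω_L (A, B) = g (A, B ∘ L)`. -/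
def IsFormOfMetric (g : Metric n M) (Ω : Form n M 2) : Prop :=
  ∀ (x : M) (A B : TangentSpace 𝓘(ℝ, Model n) x),
    Ω x ![A, B] = -(g.inner x A (H.J x B) : ℂ) + Complex.I * (g.inner x A (H.K x B) : ℂ)

/-- `Ω` is an HKT-form: it corresponds to a quaternionic Hermitian metric, and `∂Ω = 0`. -/
def IsHKTForm (Ω : Form n M 2) : Prop :=
  (∃ g : Metric n M, IsQuaternionicHermitian H g ∧ IsFormOfMetric H g Ω) ∧ del H Ω = 0

end Manifold

end

end HKT

/-! A q-real (2,0)-form η is the same thing as a symmetric bilinear form g_η(X, Y) = Re η(X, YJ)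
invariant under I, J, K, and η(X, XJ) = g_η(X, X). Put α = Ω + ∂∂_J φ and let U be the set of points
where g_α is positive definite. Everything reduces to U = M.

U is open, since positive definiteness is an open condition. At a limit point of U, g_α is positive
semidefinite, so by Cauchy–Schwarz a null vector X lies in the kernel of α, and α^n vanishes on
every tuple containing X. If X ≠ 0, complete X to a quaternionic orthogonal family a_0 = X, a_1, …,
a_{n-1} for g. On the tuple a_0, a_0 J, a_1, a_1 J, … the form Ω^n is positive, so α^n = e^f Ω^n
forces a contradiction (`eq_zero_of_mem_kernel`). Thus U is also closed.

At a local minimum of φ the Hessian is positive semidefinite, and at a critical point ∂∂_J φ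
corresponds to its quaternionic average (`metricOf_flatHessian_of_critical`), so g_α ≥ g > 0 there.
If U ≠ M, then φ has a minimum on the compact open set M ∖ U. It is a local minimum on M, hence lies
in U, which is absurd. M need not be connected (`eq_univ_of_isClopen_of_isLocalMin`).

Integrability enters in two places. For J and K it makes d(dF ∘ J) and d(dF ∘ K) invariant under J
and K respectively (`twist_invariant`), whence ∂∂_J φ is q-real. For I it gives ∂² = 0
(`holPart_extDeriv_eq_zero`), so α is ∂-closed and g_α is an HKT metric. Both are computed for
endomorphism fields on the model space and carried to M through charts. -/

namespace HKT

/-! ## Wedge powers of a two-form -/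

/-- The sequence `a (e 0), b (e 0), a (e 1), b (e 1), …`. -/
def interleave {V : Type*} (a b : ℕ → V) (e : ℕ → ℕ) (k : ℕ) : V :=
  if k % 2 = 0 then a (e (k / 2)) else b (e (k / 2))

theorem interleave_two_mul_add_mod {V : Type*} (a b : ℕ → V) (e : ℕ → ℕ) (x y : ℕ) :
    interleave a b e (2 * x + y % 2) = if y % 2 = 0 then a (e x) else b (e x) := by
  have h1 : (2 * x + y % 2) % 2 = y % 2 := by omega
  have h2 : (2 * x + y % 2) / 2 = x := by omega
  simp only [interleave, h1, h2]

section WedgePowers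

variable {V : Type*} [AddCommGroup V] [Module ℝ V]

theorem wedge_apply {p q : ℕ} (α : V [⋀^Fin p]→ₗ[ℝ] ℂ) (β : V [⋀^Fin q]→ₗ[ℝ] ℂ)
    (v : Fin (p + q) → V) :
    wedge α β v = ∑ σ : Equiv.Perm.ModSumCongr (Fin p) (Fin q), LinearMap.mul' ℝ ℂ
      (AlternatingMap.domCoprod.summand α β σ (v ∘ finSumFinEquiv)) := by
  simp only [wedge, AlternatingMap.domDomCongr_apply, LinearMap.compAlternatingMap_apply,
    AlternatingMap.domCoprod_apply, _root_.sum_apply, map_sum]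

theorem mul'_summand_mk {p q : ℕ} (α : V [⋀^Fin p]→ₗ[ℝ] ℂ) (β : V [⋀^Fin q]→ₗ[ℝ] ℂ)
    (σ : Equiv.Perm (Fin p ⊕ Fin q)) (w : Fin p ⊕ Fin q → V) :
    LinearMap.mul' ℝ ℂ (AlternatingMap.domCoprod.summand α β (Quotient.mk'' σ) w) =
      Equiv.Perm.sign σ •
        (α (fun i => w (σ (Sum.inl i))) * β (fun i => w (σ (Sum.inr i)))) := by
  rw [AlternatingMap.domCoprod.summand_mk'', _root_.smul_apply,
    MultilinearMap.domDomCongr_apply, MultilinearMap.domCoprod_apply,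
    LinearMap.map_smul_of_tower, LinearMap.mul'_apply]
  rfl

/-- In each shuffle the vector `X` is an argument of one of the two factors, which kills that term.
-/
theorem wedge_eq_zero_of_kernel {p q : ℕ} (α : V [⋀^Fin p]→ₗ[ℝ] ℂ) (β : V [⋀^Fin q]→ₗ[ℝ] ℂ)
    (X : V) (hα : ∀ u : Fin p → V, (∃ i, u i = X) → α u = 0)
    (hβ : ∀ u : Fin q → V, (∃ i, u i = X) → β u = 0)
    (v : Fin (p + q) → V) (hv : ∃ i, v i = X) : wedge α β v = 0 := by
  rw [wedge_apply]
  refine Finset.sum_eq_zero fun σ _ => ?_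
  induction σ using Quotient.inductionOn' with | _ σ
  rw [mul'_summand_mk]
  obtain ⟨i, hi⟩ := hv
  rcases h : σ⁻¹ (finSumFinEquiv.symm i) with j | j
  · rw [hα _ ⟨j, ?_⟩, zero_mul, smul_zero]
    rw [← h]; simp [hi]
  · rw [hβ _ ⟨j, ?_⟩, mul_zero, smul_zero]
    rw [← h]; simp [hi]

theorem wedgePow_eq_zero_of_kernel (η : V [⋀^Fin 2]→ₗ[ℝ] ℂ) (X : V)
    (hX : ∀ Y, η ![X, Y] = 0) (m : ℕ) (v : Fin (2 * m) → V) (hv : ∃ i, v i = X) :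
    wedgePow η m v = 0 := by
  induction m with
  | zero => exact hv.choose.elim0
  | succ m ih =>
    refine wedge_eq_zero_of_kernel (wedgePow η m) η X ih ?_ v hv
    rintro u ⟨i, hi⟩
    have h1 : u = ![u 0, u 1] := by ext j; fin_cases j <;> rfl
    fin_cases i
    · rw [h1, show u 0 = X from hi, hX]
    · have h2 := η.map_swap ![u 1, u 0] (i := 0) (j := 1) (by decide)
      have h3 : ![u 1, u 0] ∘ Equiv.swap (0 : Fin 2) 1 = u := by
        ext j; fin_cases j <;> simp
      rw [h3, show u 1 = X from hi, hX, neg_zero] at h2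
      exact h2

theorem twoForm_swap (η : V [⋀^Fin 2]→ₗ[ℝ] ℂ) (X Y : V) : η ![Y, X] = - η ![X, Y] := by
  have h2 := η.map_swap ![X, Y] (i := 0) (j := 1) (by decide)
  rw [← h2]
  congr 1
  ext j; fin_cases j <;> simp

/-- The even permutation exchanging the `i`-th pair of slots with the last pair. -/
def pairSwap (m i : ℕ) (hi : i ≤ m) : Equiv.Perm (Fin (2 * m) ⊕ Fin 2) :=
  Equiv.swap (finSumFinEquiv.symm ⟨2 * i, by omega⟩) (Sum.inr 0) *
    Equiv.swap (finSumFinEquiv.symm ⟨2 * i + 1, by omega⟩) (Sum.inr 1)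

/-- On the positions 0, …, 2m+1 the two transpositions move whole pairs and preserve parity within a
pair. Hence composing `interleave a b e` with this permutation only changes `e` to `e ∘ swap i m`.
-/
theorem finSumFinEquiv_pairSwap (m i : ℕ) (hi : i ≤ m) (x : Fin (2 * m) ⊕ Fin 2) :
    (finSumFinEquiv (pairSwap m i hi x) : ℕ) =
      2 * Equiv.swap i m ((finSumFinEquiv x : ℕ) / 2) + (finSumFinEquiv x : ℕ) % 2 := by
  obtain ⟨y, rfl⟩ := finSumFinEquiv.symm.surjective x
  have h0 : (Sum.inr 0 : Fin (2 * m) ⊕ Fin 2) = finSumFinEquiv.symm ⟨2 * m, by omega⟩ := by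
    rw [Equiv.eq_symm_apply]; ext; simp
  have h1 : (Sum.inr 1 : Fin (2 * m) ⊕ Fin 2) = finSumFinEquiv.symm ⟨2 * m + 1, by omega⟩ := by
    rw [Equiv.eq_symm_apply]; ext; simp
  simp only [pairSwap, Equiv.Perm.coe_mul, Function.comp_apply, h0, h1, Equiv.apply_symm_apply]
  simp only [Equiv.swap_apply_def, EmbeddingLike.apply_eq_iff_eq, Fin.ext_iff]
  obtain ⟨y, hy⟩ := y
  simp only
  split_ifs <;> simp_all <;> omega

theorem sign_pairSwap (m i : ℕ) (hi : i ≤ m) : Equiv.Perm.sign (pairSwap m i hi) = 1 := by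
  rw [pairSwap, Equiv.Perm.sign_mul]
  rcases hi.eq_or_lt with rfl | h
  · have h0 : (finSumFinEquiv.symm ⟨2 * i, by omega⟩ : Fin (2 * i) ⊕ Fin 2) = Sum.inr 0 := by
      rw [Equiv.symm_apply_eq]; ext; simp
    have h1 : (finSumFinEquiv.symm ⟨2 * i + 1, by omega⟩ : Fin (2 * i) ⊕ Fin 2) = Sum.inr 1 := by
      rw [Equiv.symm_apply_eq]; ext; simp
    rw [h0, h1]; simp
  · rw [Equiv.Perm.sign_swap, Equiv.Perm.sign_swap]
    · simp
    · rw [Ne, Equiv.symm_apply_eq, Fin.ext_iff]; simp; omega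
    · rw [Ne, Equiv.symm_apply_eq, Fin.ext_iff]; simp; omega

/-- A coset of shuffles is determined by the set of positions sent to the last factor; here that set
is the `i`-th pair. By finiteness, a permutation mapping the right block into itself also preserves
the left block. -/
theorem mk_eq_mk_pairSwap (m i : ℕ) (hi : i ≤ m) (σ : Equiv.Perm (Fin (2 * m) ⊕ Fin 2))
    (h0 : (finSumFinEquiv (σ (Sum.inr 0)) : ℕ) / 2 = i)
    (h1 : (finSumFinEquiv (σ (Sum.inr 1)) : ℕ) / 2 = i) :
    (Quotient.mk'' σ : Equiv.Perm.ModSumCongr (Fin (2 * m)) (Fin 2)) =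
      Quotient.mk'' (pairSwap m i hi) := by
  refine (Quotient.sound' ?_).symm
  rw [QuotientGroup.leftRel_apply]
  have key : ∀ j : Fin 2, ∃ l, ((pairSwap m i hi)⁻¹ * σ) (Sum.inr j) = Sum.inr l := by
    intro j
    have hj : (finSumFinEquiv (σ (Sum.inr j)) : ℕ) / 2 = i := by fin_cases j <;> assumption
    refine ⟨⟨(finSumFinEquiv (σ (Sum.inr j)) : ℕ) % 2, Nat.mod_lt _ (by norm_num)⟩, ?_⟩
    rw [Equiv.Perm.mul_apply, Equiv.Perm.inv_eq_iff_eq, ← finSumFinEquiv.apply_eq_iff_eq,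
      Fin.ext_iff, finSumFinEquiv_pairSwap]
    have : ∀ r, r < 2 → (2 * m + r) / 2 = m ∧ (2 * m + r) % 2 = r := by intro r hr; omega
    obtain ⟨e1, e2⟩ := this ((finSumFinEquiv (σ (Sum.inr j)) : ℕ) % 2) (Nat.mod_lt _ (by norm_num))
    simp only [finSumFinEquiv_apply_right, Fin.val_natAdd, e1, e2, Equiv.swap_apply_right]
    omega
  refine Equiv.Perm.mem_sumCongrHom_range_of_perm_mapsTo_inl ?_
  rintro _ ⟨k, rfl⟩
  rcases hk : ((pairSwap m i hi)⁻¹ * σ) (Sum.inl k) with k' | l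
  · exact ⟨k', rfl⟩
  · exfalso
    choose f hf using key
    have hfi : Function.Injective f := by
      intro x y hxy
      have := (hf x).trans ((congrArg Sum.inr hxy).trans (hf y).symm)
      exact Sum.inr_injective (Equiv.injective _ this)
    obtain ⟨j, hj⟩ := (Finite.injective_iff_surjective.mp hfi) l
    have := (hf j).trans ((congrArg Sum.inr hj).trans hk.symm)
    exact Sum.inr_ne_inl (Equiv.injective _ this)

-- In a basis adapted to `η`, a shuffle contributes only if its last two slots receive a complete
-- pair. Such a coset has the even representative `pairSwap`, so all nonzero terms are products of
-- positive numbers and nothing cancels. The reindexing `e` is kept arbitrary because removing the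
-- `i`-th pair permutes the remaining ones.
open ComplexOrder in
theorem wedgePow_interleave_pos (η : V [⋀^Fin 2]→ₗ[ℝ] ℂ) (a b : ℕ → V)
    (haa : ∀ i j, η ![a i, a j] = 0) (hbb : ∀ i j, η ![b i, b j] = 0)
    (hab : ∀ i j, i ≠ j → η ![a i, b j] = 0) (m : ℕ) (e : ℕ → ℕ) (he : Function.Injective e)
    (hpos : ∀ i < m, 0 < η ![a (e i), b (e i)]) :
    0 < wedgePow η m (fun k : Fin (2 * m) => interleave a b e k) := by
  induction m generalizing e with
  | zero => exact zero_lt_one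
  | succ m ih =>
    have hmain : ∀ i (hi : i ≤ m), 0 < LinearMap.mul' ℝ ℂ
        (AlternatingMap.domCoprod.summand (wedgePow η m) η (Quotient.mk'' (pairSwap m i hi))
          (fun x => interleave a b e (finSumFinEquiv x))) := by
      intro i hi
      rw [mul'_summand_mk, sign_pairSwap, one_smul]
      refine mul_pos ?_ ?_
      · have hval : (fun k : Fin (2 * m) => interleave a b e
            (finSumFinEquiv (pairSwap m i hi (Sum.inl k)))) =
            fun k : Fin (2 * m) => interleave a b (e ∘ Equiv.swap i m) k := by
          ext k
          rw [finSumFinEquiv_pairSwap]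
          rw [interleave_two_mul_add_mod]
          rfl
        rw [hval]
        refine ih _ (he.comp (Equiv.injective _)) fun j hj => hpos _ ?_
        rw [Equiv.swap_apply_def]
        split_ifs <;> omega
      · have hval : (fun k : Fin 2 => interleave a b e
            (finSumFinEquiv (pairSwap m i hi (Sum.inr k)))) = ![a (e i), b (e i)] := by
          ext k
          rw [finSumFinEquiv_pairSwap]
          simp only [interleave, finSumFinEquiv_apply_right, Fin.val_natAdd]
          fin_cases k
          · simp
          · simp [show (2 * m + 1) / 2 = m by omega, show (2 * m + 1) % 2 = 1 by omega]
            simp [show (2 * i + 1) / 2 = i by omega]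
        rw [hval]
        exact hpos i (by omega)
    change 0 < wedge (wedgePow η m) η _
    rw [wedge_apply]
    refine Finset.sum_pos' (fun σ _ => ?_)
      ⟨Quotient.mk'' (pairSwap m m le_rfl), Finset.mem_univ _, hmain m le_rfl⟩
    induction σ using Quotient.inductionOn' with | _ σ
    by_cases h : (finSumFinEquiv (σ (Sum.inr 0)) : ℕ) / 2 = (finSumFinEquiv (σ (Sum.inr 1)) : ℕ) / 2
    · have hi : (finSumFinEquiv (σ (Sum.inr 0)) : ℕ) / 2 ≤ m := by
        have := (finSumFinEquiv (σ (Sum.inr 0))).isLt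
        omega
      rw [mk_eq_mk_pairSwap m _ hi σ rfl h.symm]
      exact (hmain _ hi).le
    -- The last two slots receive vectors of distinct pairs, on which `η` vanishes.
    · rw [mul'_summand_mk]
      have h0 : η (fun i => ((fun k : Fin (2 * m + 2) => interleave a b e k) ∘ finSumFinEquiv)
          (σ (Sum.inr i))) = 0 := by
        have hu : (fun i => ((fun k : Fin (2 * m + 2) => interleave a b e k) ∘ finSumFinEquiv)
            (σ (Sum.inr i))) = ![interleave a b e (finSumFinEquiv (σ (Sum.inr 0))),
              interleave a b e (finSumFinEquiv (σ (Sum.inr 1)))] := by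
          ext i; fin_cases i <;> rfl
        rw [hu]
        have hne := he.ne h
        simp only [interleave]
        split_ifs
        · exact haa _ _
        · exact hab _ _ hne
        · rw [twoForm_swap, hab _ _ hne.symm, neg_zero]
        · exact hbb _ _
      refine ge_of_eq ((congrArg (fun z : ℂ => Equiv.Perm.sign σ • (wedgePow η m _ * z)) h0).trans ?_)
      rw [mul_zero, smul_zero]

end WedgePowers

/-! ## Quaternionic linear algebra -/

/-- The relations of a right action of the imaginary quaternions. -/
structure IsQuatTriple {V : Type*} [AddCommGroup V] [Module ℝ V] [TopologicalSpace V]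
    (I J K : V →L[ℝ] V) : Prop where
  II : ∀ X, I (I X) = -X
  JJ : ∀ X, J (J X) = -X
  JI : ∀ X, J (I X) = K X
  IJ : ∀ X, I (J X) = -K X

namespace IsQuatTriple

variable {V : Type*} [AddCommGroup V] [Module ℝ V] [TopologicalSpace V] {I J K : V →L[ℝ] V}

theorem KI (h : IsQuatTriple I J K) (X : V) : K (I X) = -J X := by
  rw [← h.JI, h.II, map_neg]

theorem IK (h : IsQuatTriple I J K) (X : V) : I (K X) = J X := by
  rw [← h.JI, h.IJ, h.KI, neg_neg]

theorem KJ (h : IsQuatTriple I J K) (X : V) : K (J X) = I X := by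
  rw [← neg_eq_iff_eq_neg.mpr (h.IJ (J X)), h.JJ, map_neg, neg_neg]

theorem JK (h : IsQuatTriple I J K) (X : V) : J (K X) = -I X := by
  rw [← h.JI, h.JJ]

theorem KK (h : IsQuatTriple I J K) (X : V) : K (K X) = -X := by
  rw [← h.JI X, h.KJ, h.II]

end IsQuatTriple

/-! ### Quaternionic Hermitian forms and the kernel of a solution of the Monge-Ampère equation. -/

section HermitianForms

variable {V : Type*} [AddCommGroup V] [Module ℝ V] [TopologicalSpace V]

/-- Symmetric bilinear forms invariant under `I`, `J` and `K`. -/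
structure IsHermitianForm (I J K : V →L[ℝ] V) (g : V →L[ℝ] V →L[ℝ] ℝ) : Prop where
  symm : ∀ X Y, g X Y = g Y X
  inv_I : ∀ X Y, g (I X) (I Y) = g X Y
  inv_J : ∀ X Y, g (J X) (J Y) = g X Y
  inv_K : ∀ X Y, g (K X) (K Y) = g X Y

variable {I J K : V →L[ℝ] V} {g : V →L[ℝ] V →L[ℝ] ℝ}

namespace IsHermitianForm

theorem I_left (hg : IsHermitianForm I J K g) (h : IsQuatTriple I J K) (X Y : V) :
    g (I X) Y = -g X (I Y) := by
  rw [← hg.inv_I X (I Y), h.II]; simp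

theorem J_left (hg : IsHermitianForm I J K g) (h : IsQuatTriple I J K) (X Y : V) :
    g (J X) Y = -g X (J Y) := by
  rw [← hg.inv_J X (J Y), h.JJ]; simp

theorem K_left (hg : IsHermitianForm I J K g) (h : IsQuatTriple I J K) (X Y : V) :
    g (K X) Y = -g X (K Y) := by
  rw [← hg.inv_K X (K Y), h.KK]; simp

theorem I_self (hg : IsHermitianForm I J K g) (h : IsQuatTriple I J K) (X : V) :
    g X (I X) = 0 := by
  have h1 := hg.I_left h X X
  rw [hg.symm] at h1
  linarith

/-- Invariance under `I`, `J`, `K` implies invariance under all unit quaternions. -/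
theorem unit_quaternion (hg : IsHermitianForm I J K g) (h : IsQuatTriple I J K) {a b c d : ℝ}
    (hn : a ^ 2 + b ^ 2 + c ^ 2 + d ^ 2 = 1) (X Y : V) :
    g (a • X + b • I X + c • J X + d • K X) (a • Y + b • I Y + c • J Y + d • K Y) = g X Y := by
  simp only [map_add, map_smul, _root_.add_apply, _root_.smul_apply, smul_eq_mul,
    hg.I_left h, hg.J_left h, hg.K_left h, h.II, h.JJ, h.KK, h.IJ, h.JI, h.KI, h.IK, h.KJ, h.JK,
    map_neg]
  linear_combination g X Y * hn

/-- A family of nonzero vectors orthogonal over the quaternions, starting with a given vector. -/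
theorem exists_orthogonal_family [FiniteDimensional ℝ V] (hg : IsHermitianForm I J K g)
    (h : IsQuatTriple I J K) (X : V) (hX : X ≠ 0) (k : ℕ)
    (hk : 4 * k < Module.finrank ℝ V) :
    ∃ a : ℕ → V, a 0 = X ∧ (∀ i ≤ k, a i ≠ 0) ∧ (∀ i, k < i → a i = 0) ∧
      ∀ i j, i ≠ j → g (a i) (a j) = 0 ∧ g (a i) (I (a j)) = 0 ∧ g (a i) (J (a j)) = 0 ∧
        g (a i) (K (a j)) = 0 := by
  induction k with
  | zero =>
    -- The family is extended by zero, so that orthogonality holds for all pairs of natural numbers.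
    refine ⟨fun i => if i = 0 then X else 0, by simp, ?_, ?_, ?_⟩
    · intro i hi; simp [Nat.le_zero.mp hi, hX]
    · intro i hi; simp [hi.ne']
    · intro i j hij
      by_cases hi : i = 0
      · have hj : j ≠ 0 := fun hj => hij (hi.trans hj.symm)
        simp [hj]
      · simp [hi]
  | succ k ih =>
    obtain ⟨a, ha0, hne, hzero, horth⟩ := ih (by omega)
    -- The 4(k+1) functionals pairing with `a i`, `I (a i)`, `J (a i)`, `K (a i)` for i ≤ k have a
    -- common nonzero zero because 4(k+1) < dim V; it is the next member. No definiteness of `g` is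
    -- involved.
    let L : V →ₗ[ℝ] (Fin (k + 1) × Fin 4 → ℝ) := LinearMap.pi fun p =>
      ((g (![a p.1, I (a p.1), J (a p.1), K (a p.1)] p.2) : V →L[ℝ] ℝ) : V →ₗ[ℝ] ℝ)
    have hker : LinearMap.ker L ≠ ⊥ := by
      refine LinearMap.ker_ne_bot_of_finrank_lt ?_
      simp only [Module.finrank_fintype_fun_eq_card, Fintype.card_prod, Fintype.card_fin]
      omega
    obtain ⟨v, hv, hv0⟩ := Submodule.exists_mem_ne_zero_of_ne_bot hker
    have hL : ∀ i ≤ k, ∀ j : Fin 4, g (![a i, I (a i), J (a i), K (a i)] j) v = 0 := by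
      intro i hi j
      exact congrFun (LinearMap.mem_ker.mp hv) (⟨i, by omega⟩, j)
    have hv_orth : ∀ i, i ≠ k + 1 → g (a i) v = 0 ∧ g (I (a i)) v = 0 ∧ g (J (a i)) v = 0 ∧
        g (K (a i)) v = 0 := by
      intro i hi
      rcases Nat.lt_or_ge k i with hlt | hle
      · simp [hzero i hlt]
      · exact ⟨hL i hle 0, hL i hle 1, hL i hle 2, hL i hle 3⟩
    refine ⟨Function.update a (k + 1) v, by simp [ha0], ?_, ?_, ?_⟩
    · intro i hi
      rcases eq_or_ne i (k + 1) with rfl | hi'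
      · simpa using hv0
      · rw [Function.update_of_ne hi']; exact hne i (by omega)
    · intro i hi
      rw [Function.update_of_ne (by omega)]; exact hzero i (by omega)
    · intro i j hij
      rcases eq_or_ne i (k + 1) with rfl | hi'
      · rw [Function.update_self, Function.update_of_ne hij.symm]
        obtain ⟨h1, h2, h3, h4⟩ := hv_orth j hij.symm
        exact ⟨by rw [hg.symm, h1], by rw [hg.symm, h2], by rw [hg.symm, h3], by rw [hg.symm, h4]⟩
      · rw [Function.update_of_ne hi']
        rcases eq_or_ne j (k + 1) with rfl | hj'
        · rw [Function.update_self]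
          obtain ⟨h1, h2, h3, h4⟩ := hv_orth i hi'
          rw [hg.I_left h] at h2; rw [hg.J_left h] at h3; rw [hg.K_left h] at h4
          exact ⟨h1, by linarith, by linarith, by linarith⟩
        · rw [Function.update_of_ne hj']; exact horth i j hij

end IsHermitianForm

/-- A positive semidefinite symmetric form vanishes on its null vectors. -/
theorem eq_zero_of_null (hsymm : ∀ X Y, g X Y = g Y X) (hpos : ∀ X, 0 ≤ g X X) {X : V}
    (hX : g X X = 0) (Y : V) : g X Y = 0 := by
  have key : ∀ t : ℝ, 0 ≤ 2 * t * g X Y + t ^ 2 * g Y Y := by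
    intro t
    have := hpos (X + t • Y)
    simp only [map_add, map_smul, _root_.add_apply, _root_.smul_apply, smul_eq_mul, hX,
      hsymm Y X] at this
    linarith
  by_contra hne
  -- This is the minimiser -g(X, Y) / g(Y, Y) of the quadratic in t, with 1 added to the denominator
  -- so that g(Y, Y) = 0 is covered as well.
  have h1 := key (-(g X Y) / (g Y Y + 1))
  have hY := hpos Y
  have h2 : 2 * (-(g X Y) / (g Y Y + 1)) * g X Y + (-(g X Y) / (g Y Y + 1)) ^ 2 * g Y Y =
      -(g X Y) ^ 2 * (g Y Y + 2) / (g Y Y + 1) ^ 2 := by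
    field_simp; ring
  rw [h2] at h1
  have h3 : 0 < (g X Y) ^ 2 * (g Y Y + 2) / (g Y Y + 1) ^ 2 := by positivity
  rw [neg_mul, neg_div] at h1
  linarith

/-- The form `-ω_J + √-1 ω_K` of `g`. -/
def IsFormOf (J K : V →L[ℝ] V) (g : V →L[ℝ] V →L[ℝ] ℝ) (η : V [⋀^Fin 2]→L[ℝ] ℂ) : Prop :=
  ∀ A B : V, η ![A, B] = -(g A (J B) : ℂ) + Complex.I * (g A (K B) : ℂ)

theorem cform_swap (η : V [⋀^Fin 2]→L[ℝ] ℂ) (X Y : V) : η ![Y, X] = -η ![X, Y] :=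
  twoForm_swap η.toAlternatingMap X Y

theorem cform_self (η : V [⋀^Fin 2]→L[ℝ] ℂ) (X : V) : η ![X, X] = 0 :=
  η.map_eq_zero_of_eq ![X, X] (i := 0) (j := 1) rfl (by decide)

theorem IsFormOf.mem_qReal20 (h : IsQuatTriple I J K) (hg : IsHermitianForm I J K g)
    {η : V [⋀^Fin 2]→L[ℝ] ℂ} (hη : IsFormOf J K g η) : η ∈ qReal20 I J := by
  refine ⟨fun X Y => ?_, fun X Y => ?_⟩
  · rw [hη, hη, hg.I_left h, hg.I_left h, h.IJ, h.IK]
    push_cast [map_neg]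
    linear_combination -(g X (K Y) : ℂ) * Complex.I_sq
  · rw [hη, hη, h.JJ, h.KJ, hg.J_left h (Y := I Y), h.JI, map_neg, hg.J_left h]
    simp

theorem IsFormOf.apply_J (h : IsQuatTriple I J K) (hg : IsHermitianForm I J K g)
    {η : V [⋀^Fin 2]→L[ℝ] ℂ} (hη : IsFormOf J K g η) (X : V) : η ![X, J X] = (g X X : ℂ) := by
  rw [hη, h.JJ, h.KJ, hg.I_self h]
  simp

/-- If a multiple of `η ^ n` is the `n`-th power of the form of a positive definite Hermitian form,
then `η` has no kernel. -/
theorem eq_zero_of_mem_kernel [FiniteDimensional ℝ V] (h : IsQuatTriple I J K)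
    (hg : IsHermitianForm I J K g) (hpos : ∀ X, X ≠ 0 → 0 < g X X)
    {n : ℕ} (hn : Module.finrank ℝ V = 4 * n) {η Ω : V [⋀^Fin 2]→L[ℝ] ℂ} (hΩ : IsFormOf J K g Ω)
    {c : ℝ} (hc : c ≠ 0)
    (hpow : wedgePow η.toAlternatingMap n = c • wedgePow Ω.toAlternatingMap n)
    {X : V} (hX : ∀ Y, η ![X, Y] = 0) : X = 0 := by
  open ComplexOrder in
  by_contra hX0
  have hn0 : 0 < n := by
    have : Nontrivial V := ⟨X, 0, hX0⟩
    have := Module.finrank_pos (R := ℝ) (M := V)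
    omega
  obtain ⟨a, ha0, hne, -, horth⟩ := hg.exists_orthogonal_family h X hX0 (n - 1) (by omega)
  -- For vectors that are orthogonal over the quaternions, `Ω` pairs `a i` only with `J (a i)`, with
  -- value g(a i, a i) > 0.
  have hΩpos : 0 < wedgePow Ω.toAlternatingMap n
      (fun k : Fin (2 * n) => interleave a (fun i => J (a i)) id k) := by
    refine wedgePow_interleave_pos _ _ _ ?_ ?_ ?_ n id Function.injective_id ?_
    · intro i j
      rcases eq_or_ne i j with rfl | hij
      · exact cform_self Ω _
      · obtain ⟨-, -, h3, h4⟩ := horth i j hij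
        refine (hΩ _ _).trans ?_
        rw [h3, h4]; simp
    · intro i j
      rcases eq_or_ne i j with rfl | hij
      · exact cform_self Ω _
      · obtain ⟨-, -, h3, h4⟩ := horth i j hij
        refine (hΩ _ _).trans ?_
        rw [h.JJ, h.KJ, hg.J_left h (Y := I _), h.JI, h4, map_neg, hg.J_left h, h3]; simp
    · intro i j hij
      obtain ⟨h1, h2, -, -⟩ := horth i j hij
      refine (hΩ _ _).trans ?_
      rw [h.JJ, h.KJ, h2, map_neg, h1]; simp
    · intro i hi
      refine lt_of_lt_of_eq ?_ (hΩ.apply_J h hg (a i)).symm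
      exact_mod_cast hpos _ (hne i (by omega))
  have hηzero := wedgePow_eq_zero_of_kernel η.toAlternatingMap X hX n
    (fun k : Fin (2 * n) => interleave a (fun i => J (a i)) id k)
    ⟨⟨0, by omega⟩, by simp [interleave, ha0]⟩
  rw [hpow, AlternatingMap.smul_apply] at hηzero
  exact hΩpos.ne' ((smul_eq_zero_iff_right hc).mp hηzero)

end HermitianForms

/-! ## The Hermitian form of a q-real form, and the interior of the positive cone -/

section TwoForms

variable {V : Type*} [AddCommGroup V] [Module ℝ V] [TopologicalSpace V] (η : V [⋀^Fin 2]→L[ℝ] ℂ)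

theorem cform_add_left (X X' Y : V) : η ![X + X', Y] = η ![X, Y] + η ![X', Y] :=
  η.toAlternatingMap.map_vecCons_add ![Y] X X'

theorem cform_smul_left (c : ℝ) (X Y : V) : η ![c • X, Y] = c * η ![X, Y] :=
  (η.toAlternatingMap.map_vecCons_smul ![Y] c X).trans (Complex.real_smul)

theorem cform_add_right (X Y Y' : V) : η ![X, Y + Y'] = η ![X, Y] + η ![X, Y'] := by
  rw [cform_swap, cform_add_left, neg_add, ← cform_swap, ← cform_swap]

theorem cform_smul_right (c : ℝ) (X Y : V) : η ![X, c • Y] = c * η ![X, Y] := by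
  rw [cform_swap, cform_smul_left, ← mul_neg, ← cform_swap]

theorem cform_neg_left (X Y : V) : η ![-X, Y] = -η ![X, Y] := by
  simpa using cform_smul_left η (-1) X Y

theorem cform_neg_right (X Y : V) : η ![X, -Y] = -η ![X, Y] := by
  simpa using cform_smul_right η (-1) X Y

theorem cform_sub_left (X X' Y : V) : η ![X - X', Y] = η ![X, Y] - η ![X', Y] := by
  rw [sub_eq_add_neg, cform_add_left, cform_neg_left, sub_eq_add_neg]

theorem holPart_two_apply (I : V →L[ℝ] V) (X Y : V) :
    holPart I η ![X, Y] = 4⁻¹ * (η ![X, Y] - Complex.I * η ![I X, Y] - Complex.I * η ![X, I Y]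
      - η ![I X, I Y]) := by
  change holPartAux I η ![X, Y] = _
  have huniv : (Finset.univ : Finset (Finset (Fin 2))) = {∅, {0}, {1}, {0, 1}} := by decide
  have h0 : (fun i => if i ∈ (∅ : Finset (Fin 2)) then I (![X, Y] i) else ![X, Y] i) =
      ![X, Y] := by
    ext i; fin_cases i <;> simp
  have h1 : (fun i => if i ∈ ({0} : Finset (Fin 2)) then I (![X, Y] i) else ![X, Y] i) =
      ![I X, Y] := by
    ext i; fin_cases i <;> simp
  have h2 : (fun i => if i ∈ ({1} : Finset (Fin 2)) then I (![X, Y] i) else ![X, Y] i) =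
      ![X, I Y] := by
    ext i; fin_cases i <;> simp
  have h3 : (fun i => if i ∈ ({0, 1} : Finset (Fin 2)) then I (![X, Y] i) else ![X, Y] i) =
      ![I X, I Y] := by
    ext i; fin_cases i <;> simp
  rw [holPartAux_apply, huniv, Finset.sum_insert (by decide), Finset.sum_insert (by decide),
    Finset.sum_insert (by decide), Finset.sum_singleton, h0, h1, h2, h3,
    Finset.card_pair (by decide)]
  simp only [Finset.card_empty, Finset.card_singleton, pow_zero, pow_one]
  linear_combination (4⁻¹ * η ![I X, I Y]) * Complex.I_sq

theorem holPart_one_apply (I : V →L[ℝ] V) (α : V [⋀^Fin 1]→L[ℝ] ℂ) (X : V) :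
    holPart I α ![X] = 2⁻¹ * (α ![X] - Complex.I * α ![I X]) := by
  change holPartAux I α ![X] = _
  have huniv : (Finset.univ : Finset (Finset (Fin 1))) = {∅, {0}} := by decide
  have h0 : (fun i => if i ∈ (∅ : Finset (Fin 1)) then I (![X] i) else ![X] i) = ![X] := by
    ext i; fin_cases i; simp
  have h1 : (fun i => if i ∈ ({0} : Finset (Fin 1)) then I (![X] i) else ![X] i) = ![I X] := by
    ext i; fin_cases i; simp
  rw [holPartAux_apply, huniv, Finset.sum_insert (by decide), Finset.sum_singleton, h0, h1]
  simp only [Finset.card_empty, Finset.card_singleton, pow_zero, pow_one]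
  ring

theorem holPart_three_apply (I : V →L[ℝ] V) (α : V [⋀^Fin 3]→L[ℝ] ℂ) (X Y Z : V) :
    holPart I α ![X, Y, Z] = 8⁻¹ * (α ![X, Y, Z] - Complex.I * (α ![I X, Y, Z] +
      α ![X, I Y, Z] + α ![X, Y, I Z]) - (α ![I X, I Y, Z] + α ![I X, Y, I Z] + α ![X, I Y, I Z])
      + Complex.I * α ![I X, I Y, I Z]) := by
  change holPartAux I α ![X, Y, Z] = _
  have huniv : (Finset.univ : Finset (Finset (Fin 3))) =
      {∅, {0}, {1}, {2}, {0, 1}, {0, 2}, {1, 2}, {0, 1, 2}} := by decide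
  have hite : ∀ s : Finset (Fin 3), (fun i => if i ∈ s then I (![X, Y, Z] i) else ![X, Y, Z] i) =
      ![if 0 ∈ s then I X else X, if 1 ∈ s then I Y else Y, if 2 ∈ s then I Z else Z] := by
    intro s; ext i; fin_cases i <;> rfl
  rw [holPartAux_apply, huniv]
  simp only [hite]
  iterate 7 rw [Finset.sum_insert (by decide)]
  rw [Finset.sum_singleton]
  have c2 : ∀ i j : Fin 3, i ≠ j → ({i, j} : Finset (Fin 3)).card = 2 := fun i j h =>
    Finset.card_pair h
  have c3 : ({0, 1, 2} : Finset (Fin 3)).card = 3 := by decide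
  rw [c2 0 1 (by decide), c2 0 2 (by decide), c2 1 2 (by decide), c3]
  simp only [Finset.card_empty, Finset.card_singleton, pow_zero, pow_one, Finset.mem_insert,
    Finset.mem_singleton, Finset.notMem_empty, if_false, Fin.isValue, or_false, or_true,
    if_true, show ¬((0 : Fin 3) = 1) by decide, show ¬((0 : Fin 3) = 2) by decide,
    show ¬((1 : Fin 3) = 0) by decide, show ¬((1 : Fin 3) = 2) by decide,
    show ¬((2 : Fin 3) = 0) by decide, show ¬((2 : Fin 3) = 1) by decide, or_self]
  linear_combination (8⁻¹ * (α ![I X, I Y, Z] + α ![I X, Y, I Z] + α ![X, I Y, I Z]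
    - Complex.I * α ![I X, I Y, I Z])) * Complex.I_sq

theorem holPart_add (I : V →L[ℝ] V) {k : ℕ} (α β : V [⋀^Fin k]→L[ℝ] ℂ) :
    holPart I (α + β) = holPart I α + holPart I β := by
  ext v
  refine (holPartAux_apply I (α + β) v).trans (Eq.trans ?_ (congrArg₂ (· + ·)
    (holPartAux_apply I α v).symm (holPartAux_apply I β v).symm))
  simp only [ContinuousAlternatingMap.add_apply, mul_add, Finset.sum_add_distrib]

theorem holPart_smul (I : V →L[ℝ] V) {k : ℕ} (c : ℝ) (α : V [⋀^Fin k]→L[ℝ] ℂ) :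
    holPart I (c • α) = c • holPart I α := by
  ext v
  refine (holPartAux_apply I (c • α) v).trans (Eq.trans ?_ (congrArg (c • ·)
    (holPartAux_apply I α v).symm))
  simp only [ContinuousAlternatingMap.smul_apply, mul_smul_comm, ← Finset.smul_sum]

variable {η} in
theorem cform_ext {ζ : V [⋀^Fin 2]→L[ℝ] ℂ} (h : ∀ X Y, η ![X, Y] = ζ ![X, Y]) : η = ζ := by
  ext v
  have hv : v = ![v 0, v 1] := by ext j; fin_cases j <;> rfl
  rw [hv]; exact h _ _

/-- `holPart` is a projection on two-forms. -/
theorem holPart_two_idem (I : V →L[ℝ] V) (hI : ∀ X, I (I X) = -X) :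
    holPart I (holPart I η) = holPart I η := by
  refine cform_ext fun X Y => ?_
  simp only [holPart_two_apply, hI, cform_neg_left, cform_neg_right]
  linear_combination (4⁻¹ * 4⁻¹ * (2 * η ![I X, I Y] - 2 * η ![X, Y])) * Complex.I_sq

variable {η} {I J K : V →L[ℝ] V}

theorem qReal20_I_right (hη : η ∈ qReal20 I J) (X Y : V) :
    η ![X, I Y] = Complex.I * η ![X, Y] := by
  rw [cform_swap, hη.1, ← mul_neg, ← cform_swap]

theorem qReal20_conj (h : IsQuatTriple I J K) (hη : η ∈ qReal20 I J) (X Y : V) :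
    (starRingEnd ℂ) (η ![X, J Y]) = η ![Y, J X] := by
  have h1 := hη.2 Y (J X)
  rw [h.JJ, cform_neg_right, cform_swap, neg_neg] at h1
  exact h1

end TwoForms

/-! ### The correspondence between q-real (2,0)-forms and Hermitian forms. -/

section MetricOf

variable {V : Type*} [AddCommGroup V] [Module ℝ V] [TopologicalSpace V] [IsTopologicalAddGroup V]
  [ContinuousSMul ℝ V] [T2Space V] [FiniteDimensional ℝ V]

/-- The bilinear form `(X, Y) ↦ Re η (X, Y J)`. -/
noncomputable def metricOf (J : V →L[ℝ] V) (η : V [⋀^Fin 2]→L[ℝ] ℂ) : V →L[ℝ] V →L[ℝ] ℝ :=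
  (LinearMap.mk₂ ℝ (fun X Y => (η ![X, J Y]).re)
    (fun X X' Y => by rw [cform_add_left, Complex.add_re])
    (fun c X Y => by rw [cform_smul_left, Complex.re_ofReal_mul, smul_eq_mul])
    (fun X Y Y' => by rw [map_add, cform_add_right, Complex.add_re])
    (fun c X Y => by
      rw [map_smul, cform_smul_right, Complex.re_ofReal_mul, smul_eq_mul])).toContinuousBilinearMap

theorem metricOf_apply (J : V →L[ℝ] V) (η : V [⋀^Fin 2]→L[ℝ] ℂ) (X Y : V) :
    metricOf J η X Y = (η ![X, J Y]).re := rfl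

variable {I J K : V →L[ℝ] V} {η : V [⋀^Fin 2]→L[ℝ] ℂ}

/-- Type (2,0) gives invariance under `I`, since √-1 appears twice and `J` anticommutes with `I`.
The reality condition gives invariance under `J` and, with antisymmetry of `η`, the symmetry.
Invariance under `K` follows as `K` is the composite of `I` and `J`. -/
theorem isHermitianForm_metricOf (h : IsQuatTriple I J K) (hη : η ∈ qReal20 I J) :
    IsHermitianForm I J K (metricOf J η) := by
  have hI : ∀ X Y, metricOf J η (I X) (I Y) = metricOf J η X Y := by
    intro X Y
    rw [metricOf_apply, metricOf_apply, h.JI, ← neg_eq_iff_eq_neg.mpr (h.IJ Y), hη.1,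
      cform_neg_right, qReal20_I_right hη]
    congr 1
    linear_combination (-η ![X, J Y]) * Complex.I_sq
  have hJ : ∀ X Y, metricOf J η (J X) (J Y) = metricOf J η X Y := by
    intro X Y
    rw [metricOf_apply, metricOf_apply, ← hη.2 X (J Y), Complex.conj_re]
  refine ⟨fun X Y => ?_, hI, hJ, fun X Y => ?_⟩
  · rw [metricOf_apply, metricOf_apply, ← qReal20_conj h hη, Complex.conj_re]
  · rw [← h.JI, ← h.JI, hJ, hI]

/-- The real part is recovered from J² = -1. For the imaginary part, `J (K B) = -I B` and type (2,0)
turn Re η(A, JKB) into Im η(A, B). -/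
theorem isFormOf_metricOf (h : IsQuatTriple I J K) (hη : η ∈ qReal20 I J) :
    IsFormOf J K (metricOf J η) η := by
  intro A B
  rw [metricOf_apply, metricOf_apply, h.JJ, h.JK, cform_neg_right, cform_neg_right,
    qReal20_I_right hη]
  apply Complex.ext <;> simp

theorem qReal20_apply_J (h : IsQuatTriple I J K) (hη : η ∈ qReal20 I J) (X : V) :
    η ![X, J X] = (metricOf J η X X : ℂ) :=
  (isFormOf_metricOf h hη).apply_J h (isHermitianForm_metricOf h hη) X

/-- A null vector of a positive semidefinite q-real form lies in its kernel. -/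
theorem kernel_of_null (h : IsQuatTriple I J K) (hη : η ∈ qReal20 I J)
    (hpos : ∀ X, 0 ≤ metricOf J η X X) {X : V} (hX : metricOf J η X X = 0) (Y : V) :
    η ![X, Y] = 0 := by
  have h0 := eq_zero_of_null (isHermitianForm_metricOf h hη).symm hpos hX
  rw [isFormOf_metricOf h hη X Y, h0, h0]
  simp

end MetricOf

/-! ### Definite forms are interior points of the cone. -/

section Interior

variable {V : Type*} [NormedAddCommGroup V] [NormedSpace ℝ V] [FiniteDimensional ℝ V]
  {I J K : V →L[ℝ] V}

/-- The constant is the minimum of `q` on the compact unit sphere; the sphere is empty only when V =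
0. -/
theorem exists_pos_mul_sq_le (q : V → ℝ) (hq : Continuous q)
    (hsmul : ∀ (c : ℝ) X, q (c • X) = c ^ 2 * q X) (hpos : ∀ X, X ≠ 0 → 0 < q X) :
    ∃ c > 0, ∀ X, c * ‖X‖ ^ 2 ≤ q X := by
  have hq0 : q 0 = 0 := by simpa using hsmul 0 0
  rcases (Metric.sphere (0 : V) 1).eq_empty_or_nonempty with hem | hne
  · refine ⟨1, one_pos, fun X => ?_⟩
    have hX : X = 0 := by
      by_contra hX
      have : ‖X‖⁻¹ • X ∈ Metric.sphere (0 : V) 1 := by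
        simp [norm_smul, inv_mul_cancel₀ (norm_ne_zero_iff.mpr hX)]
      rw [hem] at this
      exact this
    simp [hX, hq0]
  · obtain ⟨X₀, hX₀, hmin⟩ := (isCompact_sphere (0 : V) 1).exists_isMinOn hne hq.continuousOn
    refine ⟨q X₀, hpos _ (Metric.ne_of_mem_sphere hX₀ one_ne_zero), fun X => ?_⟩
    rcases eq_or_ne X 0 with rfl | hX
    · simp [hq0]
    · have hn := norm_pos_iff.mpr hX
      have h1 : ‖X‖⁻¹ • X ∈ Metric.sphere (0 : V) 1 := by
        simp [norm_smul, inv_mul_cancel₀ hn.ne']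
      have h2 : q X₀ ≤ q (‖X‖⁻¹ • X) := hmin h1
      rw [hsmul, inv_pow] at h2
      rwa [← div_eq_inv_mul, le_div_iff₀ (by positivity)] at h2

theorem exists_pos_mul_sq_le_bilin (g : V →L[ℝ] V →L[ℝ] ℝ) (hpos : ∀ X, X ≠ 0 → 0 < g X X) :
    ∃ c > 0, ∀ X, c * ‖X‖ ^ 2 ≤ g X X := by
  refine exists_pos_mul_sq_le (fun X => g X X) (by fun_prop) (fun c X => ?_) hpos
  simp only [map_smul, _root_.smul_apply, smul_eq_mul]
  ring

theorem mem_interior_qPositiveCone (h : IsQuatTriple I J K) (η : qReal20 I J)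
    (hpos : ∀ X, X ≠ 0 → 0 < metricOf J (η : V [⋀^Fin 2]→L[ℝ] ℂ) X X) :
    η ∈ interior (qPositiveCone I J) := by
  open ComplexOrder in
  obtain ⟨c, hc, hcX⟩ := exists_pos_mul_sq_le_bilin _ hpos
  rw [mem_interior_iff_mem_nhds, Metric.mem_nhds_iff]
  -- A perturbation of norm r changes the value at X by at most r‖J‖‖X‖², which this radius keeps
  -- below c‖X‖². The 1 avoids division by zero when J = 0.
  refine ⟨c / (‖J‖ + 1), by positivity, fun ζ hζ X => ?_⟩
  rw [qReal20_apply_J h ζ.2]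
  have h1 : ‖((ζ : V [⋀^Fin 2]→L[ℝ] ℂ) - η) ![X, J X]‖ ≤ c / (‖J‖ + 1) * ‖X‖ * (‖J‖ * ‖X‖) := by
    have h2 := ((ζ : V [⋀^Fin 2]→L[ℝ] ℂ) - η).le_opNorm ![X, J X]
    rw [Fin.prod_univ_two] at h2
    refine h2.trans ?_
    have h3 : ‖(ζ : V [⋀^Fin 2]→L[ℝ] ℂ) - η‖ ≤ c / (‖J‖ + 1) := by
      have := (Metric.mem_ball.mp hζ).le
      rwa [Subtype.dist_eq, dist_eq_norm] at this
    rw [← mul_assoc]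
    change _ * ‖X‖ * ‖J X‖ ≤ _
    gcongr
    exact J.le_opNorm X
  have h4 := (Complex.abs_re_le_norm _).trans h1
  rw [ContinuousAlternatingMap.sub_apply, Complex.sub_re, ← metricOf_apply, ← metricOf_apply] at h4
  have h5 : c / (‖J‖ + 1) * ‖X‖ * (‖J‖ * ‖X‖) ≤ c * ‖X‖ ^ 2 := by
    have : c / (‖J‖ + 1) * ‖J‖ ≤ c := by
      rw [div_mul_eq_mul_div, div_le_iff₀ (by positivity)]
      nlinarith [norm_nonneg J]
    nlinarith [sq_nonneg ‖X‖]
  have h6 := hcX X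
  have h7 := (abs_le.mp h4).1
  exact_mod_cast (by linarith : 0 ≤ metricOf J (ζ : V [⋀^Fin 2]→L[ℝ] ℂ) X X)

end Interior

/-! ## Smooth families of alternating forms on a vector space -/

section SmoothForms

variable {E : Type*} [NormedAddCommGroup E] [NormedSpace ℝ E] [FiniteDimensional ℝ E]
  {G : Type*} [NormedAddCommGroup G] [NormedSpace ℝ G] {k : ℕ} {m : WithTop ℕ∞}

instance finiteDimensional_form : FiniteDimensional ℝ (E [⋀^Fin k]→L[ℝ] ℂ) :=
  FiniteDimensional.of_injective
    ({ toFun := fun w => w.toAlternatingMap.toMultilinearMap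
       map_add' := fun _ _ => rfl
       map_smul' := fun _ _ => rfl } :
      (E [⋀^Fin k]→L[ℝ] ℂ) →ₗ[ℝ] MultilinearMap ℝ (fun _ : Fin k => E) ℂ)
    (fun a b hab => by ext v; exact congrArg (fun f => f v) hab)

/-- A form is a linear function of its finitely many values on basis tuples, through a left inverse
of the evaluation map. -/
theorem contDiffAt_form {w : G → E [⋀^Fin k]→L[ℝ] ℂ} {x : G}
    (h : ∀ v, ContDiffAt ℝ m (fun y => w y v) x) : ContDiffAt ℝ m w x := by
  let b := Module.finBasis ℝ E
  let ev : (E [⋀^Fin k]→L[ℝ] ℂ) →ₗ[ℝ] ((Fin k → Fin (Module.finrank ℝ E)) → ℂ) :=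
    { toFun := fun w r => w (fun i => b (r i))
      map_add' := fun _ _ => rfl
      map_smul' := fun _ _ => rfl }
  have hev : Function.Injective ev := by
    intro α β hab
    have : α.toAlternatingMap = β.toAlternatingMap := by
      refine AlternatingMap.coe_multilinearMap_injective ?_
      exact Module.Basis.ext_multilinear (fun _ => b) fun r => congrFun hab r
    ext v
    exact congrArg (fun f => f v) this
  obtain ⟨l, hl⟩ := ev.exists_leftInverse_of_injective (LinearMap.ker_eq_bot.mpr hev)
  have h1 : w = fun y => LinearMap.toContinuousLinearMap l (ev (w y)) := by
    ext1 y
    exact (LinearMap.congr_fun hl (w y)).symm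
  rw [h1]
  refine (LinearMap.toContinuousLinearMap l).contDiff.contDiffAt.comp x ?_
  exact contDiffAt_pi.mpr fun r => h _

theorem contDiffAt_form_apply {w : G → E [⋀^Fin k]→L[ℝ] ℂ} {v : G → Fin k → E} {x : G}
    (hw : ContDiffAt ℝ m w x) (hv : ∀ i, ContDiffAt ℝ m (fun y => v y i) x) :
    ContDiffAt ℝ m (fun y => w y (v y)) x := by
  let b := Module.finBasis ℝ E
  have hconst : ∀ u : Fin k → E, ContDiffAt ℝ m (fun y => w y u) x := by
    intro u
    let L : (E [⋀^Fin k]→L[ℝ] ℂ) →ₗ[ℝ] ℂ :=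
      { toFun := fun w => w u
        map_add' := fun _ _ => rfl
        map_smul' := fun _ _ => rfl }
    exact (LinearMap.toContinuousLinearMap L).contDiff.contDiffAt.comp x hw
  have h1 : (fun y => w y (v y)) = fun y => ∑ r : Fin k → Fin (Module.finrank ℝ E),
      (∏ i, b.repr (v y i) (r i)) • w y (fun i => b (r i)) := by
    ext1 y
    have h2 : v y = fun i => ∑ j, b.repr (v y i) j • b j := by
      ext1 i; exact (b.sum_repr _).symm
    conv_lhs => rw [h2]
    have h3 := (w y).toAlternatingMap.toMultilinearMap.map_sum
      (fun i j => b.repr (v y i) j • b j)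
    refine h3.trans (Finset.sum_congr rfl fun r _ => ?_)
    exact (w y).toAlternatingMap.toMultilinearMap.map_smul_univ _ _
  rw [h1]
  refine ContDiffAt.sum fun r _ => ContDiffAt.fun_smul ?_ (hconst _)
  refine contDiffAt_prod fun i _ => ?_
  exact (LinearMap.toContinuousLinearMap (b.coord (r i))).contDiff.contDiffAt.comp x (hv i)

theorem contDiffAt_comp_form {w : G → E [⋀^Fin k]→L[ℝ] ℂ} {L : G → E →L[ℝ] E} {x : G}
    (hw : ContDiffAt ℝ m w x) (hL : ContDiffAt ℝ m L x) :
    ContDiffAt ℝ m (fun y => (w y).compContinuousLinearMap (L y)) x :=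
  contDiffAt_form fun v => contDiffAt_form_apply (v := fun y i => L y (v i)) hw
    fun _ => hL.clm_apply contDiffAt_const

theorem contDiffAt_holPart {w : G → E [⋀^Fin k]→L[ℝ] ℂ} {L : G → E →L[ℝ] E} {x : G}
    (hw : ContDiffAt ℝ m w x) (hL : ContDiffAt ℝ m L x) :
    ContDiffAt ℝ m (fun y => holPart (L y) (w y)) x := by
  refine contDiffAt_form fun v => ?_
  have h1 : (fun y => holPart (L y) (w y) v) = fun y => ((2 : ℂ)⁻¹ ^ k) *
      ∑ s : Finset (Fin k), ((-Complex.I) ^ s.card) *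
        w y (fun i => if i ∈ s then L y (v i) else v i) := by
    ext1 y; exact holPartAux_apply _ _ _
  rw [h1]
  refine contDiffAt_const.mul (ContDiffAt.sum fun s _ => contDiffAt_const.mul ?_)
  refine contDiffAt_form_apply hw fun i => ?_
  by_cases hi : i ∈ s
  · simp only [hi, if_true]; exact hL.clm_apply contDiffAt_const
  · simp only [hi, if_false]; exact contDiffAt_const

end SmoothForms

/-! ## Hypercomplex structures near a point of a vector space -/

section Flat

variable {E : Type*} [NormedAddCommGroup E] [NormedSpace ℝ E]

/-- Smooth fields of endomorphisms near `z`, forming a quaternionic triple, whose Nijenhuis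
tensors vanish at `z`. -/
structure IsHypercomplexAt (I J K : E → E →L[ℝ] E) (z : E) : Prop where
  smooth_I : ContDiffAt ℝ ∞ I z
  smooth_J : ContDiffAt ℝ ∞ J z
  smooth_K : ContDiffAt ℝ ∞ K z
  triple : ∀ᶠ y in 𝓝 z, IsQuatTriple (I y) (J y) (K y)
  nij_I : ∀ X Y, I z (fderiv ℝ I z X Y - fderiv ℝ I z Y X) =
    fderiv ℝ I z (I z X) Y - fderiv ℝ I z (I z Y) X
  nij_J : ∀ X Y, J z (fderiv ℝ J z X Y - fderiv ℝ J z Y X) =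
    fderiv ℝ J z (J z X) Y - fderiv ℝ J z (J z Y) X
  nij_K : ∀ X Y, K z (fderiv ℝ K z X Y - fderiv ℝ K z Y X) =
    fderiv ℝ K z (K z X) Y - fderiv ℝ K z (K z Y) X

theorem contDiffAt_extDeriv {k : ℕ} {w : E → E [⋀^Fin k]→L[ℝ] ℂ} {x : E}
    (hw : ContDiffAt ℝ ∞ w x) : ContDiffAt ℝ ∞ (extDeriv w) x := by
  have h1 : extDeriv w = fun y =>
      ContinuousAlternatingMap.alternatizeUncurryFinCLM ℝ E ℂ (fderiv ℝ w y) := rfl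
  rw [h1]
  exact ContDiffAt.continuousLinearMap_comp _ (hw.fderiv_right (m := ∞) le_rfl)

theorem extDeriv_two_apply {w : E → E [⋀^Fin 1]→L[ℝ] ℂ} {x : E} (h : DifferentiableAt ℝ w x)
    (X Y : E) : extDeriv w x ![X, Y] =
      fderiv ℝ (fun y => w y ![Y]) x X - fderiv ℝ (fun y => w y ![X]) x Y := by
  rw [extDeriv_apply h, Fin.sum_univ_two]
  have h0 : (0 : Fin 2).removeNth ![X, Y] = ![Y] := by ext i; fin_cases i; rfl
  have h1 : (1 : Fin 2).removeNth ![X, Y] = ![X] := by ext i; fin_cases i; rfl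
  rw [h0, h1]
  simp [sub_eq_add_neg]

theorem extDeriv_three_apply {w : E → E [⋀^Fin 2]→L[ℝ] ℂ} {x : E} (X Y Z : E) : extDeriv w x ![X, Y, Z] =
      fderiv ℝ w x X ![Y, Z] - fderiv ℝ w x Y ![X, Z] + fderiv ℝ w x Z ![X, Y] := by
  rw [extDeriv, ContinuousAlternatingMap.alternatizeUncurryFin_apply, Fin.sum_univ_three]
  have h0 : (0 : Fin 3).removeNth ![X, Y, Z] = ![Y, Z] := by ext i; fin_cases i <;> rfl
  have h1 : (1 : Fin 3).removeNth ![X, Y, Z] = ![X, Z] := by ext i; fin_cases i <;> rfl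
  have h2 : (2 : Fin 3).removeNth ![X, Y, Z] = ![X, Y] := by ext i; fin_cases i <;> rfl
  rw [h0, h1, h2]
  simp [sub_eq_add_neg]

/-- Differentiate L² = -1. -/
theorem fderiv_anticommute {L : E → E →L[ℝ] E} {z : E} (hL : DifferentiableAt ℝ L z)
    (hsq : ∀ᶠ y in 𝓝 z, ∀ X, L y (L y X) = -X) (X Y : E) :
    fderiv ℝ L z X (L z Y) = -L z (fderiv ℝ L z X Y) := by
  have h1 : HasFDerivAt (fun y => L y (L y Y)) _ z :=
    hL.hasFDerivAt.clm_apply (hL.hasFDerivAt.clm_apply (hasFDerivAt_const Y z))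
  have h2 : HasFDerivAt (fun y => L y (L y Y)) (0 : E →L[ℝ] E) z :=
    (hasFDerivAt_const (-Y) z).congr_of_eventuallyEq (hsq.mono fun y hy => hy Y)
  have h3 := congrArg (fun f : E →L[ℝ] E => f X) (h1.unique h2)
  simp at h3
  rw [add_comm] at h3
  exact eq_neg_of_add_eq_zero_left h3

/-- The exterior derivative at `z` of the one-form `X ↦ dF (L X)`. -/
noncomputable def twist (F : E → ℝ) (L : E → E →L[ℝ] E) (z X Y : E) : ℝ :=
  fderiv ℝ (fderiv ℝ F) z X (L z Y) - fderiv ℝ (fderiv ℝ F) z Y (L z X)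
    + fderiv ℝ F z (fderiv ℝ L z X Y - fderiv ℝ L z Y X)

/-- For an integrable complex structure the two-form d(dF ∘ L) is of type (1,1). The second-order
terms agree by symmetry of the Hessian, and the first-order terms by the Nijenhuis identity together
with `fderiv_anticommute`. -/
theorem twist_invariant {F : E → ℝ} {z : E} (hF : ContDiffAt ℝ ∞ F z) {L : E → E →L[ℝ] E}
    (hL : DifferentiableAt ℝ L z) (hsq : ∀ᶠ y in 𝓝 z, ∀ X, L y (L y X) = -X)
    (hnij : ∀ X Y, L z (fderiv ℝ L z X Y - fderiv ℝ L z Y X) =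
      fderiv ℝ L z (L z X) Y - fderiv ℝ L z (L z Y) X) (X Y : E) :
    twist F L z (L z X) (L z Y) = twist F L z X Y := by
  have hs : IsSymmSndFDerivAt ℝ F z := hF.isSymmSndFDerivAt (by simp; exact WithTop.coe_le_coe.mpr le_top)
  have hz := hsq.self_of_nhds
  simp only [twist, hz, fderiv_anticommute hL hsq, map_neg]
  have h1 : fderiv ℝ L z X Y - fderiv ℝ L z Y X =
      -L z (fderiv ℝ L z (L z X) Y) - -L z (fderiv ℝ L z (L z Y) X) := by
    rw [← neg_inj, ← hz, hnij, map_sub]; abel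
  rw [h1, hs.eq (L z X) Y, hs.eq (L z Y) X]
  ring

theorem twist_neg_left (F : E → ℝ) (L : E → E →L[ℝ] E) (z X Y : E) :
    twist F L z (-X) Y = -twist F L z X Y := by
  simp only [twist, map_neg, _root_.neg_apply, map_sub]; ring

theorem twist_neg_right (F : E → ℝ) (L : E → E →L[ℝ] E) (z X Y : E) :
    twist F L z X (-Y) = -twist F L z X Y := by
  simp only [twist, map_neg, _root_.neg_apply, map_sub]; ring

/-- The `(2,0)`-part of `(-A + √-1 B) / 2` is q-real when `A` is `J`-invariant and `B` is
`K`-invariant. -/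
theorem holPart_mem_qReal20 {I J K : E →L[ℝ] E} (h : IsQuatTriple I J K) {A B : E → E → ℝ}
    (hA : ∀ X Y, A (J X) (J Y) = A X Y) (hB : ∀ X Y, B (K X) (K Y) = B X Y)
    {w : E [⋀^Fin 2]→L[ℝ] ℂ}
    (hw : ∀ X Y, w ![X, Y] = 2⁻¹ * (-(A X Y : ℂ) + Complex.I * B X Y))
    (hAl : ∀ X Y, A (-X) Y = -A X Y) (hAr : ∀ X Y, A X (-Y) = -A X Y)
    (hBl : ∀ X Y, B (-X) Y = -B X Y) (hBr : ∀ X Y, B X (-Y) = -B X Y) :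
    holPart I w ∈ qReal20 I J := by
  refine ⟨fun X Y => ?_, fun X Y => ?_⟩
  · simp only [holPart_two_apply, h.II, cform_neg_left]
    linear_combination (4⁻¹ * (w ![I X, Y] + w ![X, I Y] * 0)) * Complex.I_sq
      + (4⁻¹ * w ![X, I Y]) * Complex.I_sq
  -- The identities remove `J` and `K` from all arguments, moving those of `A` by `J`-invariance and
  -- those of `B` by `K`-invariance. Both sides then involve only X, Y, `I X` and `I Y`.
  · have e1 : A (K X) (K Y) = A (I X) (I Y) := by rw [← h.JI, ← h.JI, hA]
    have e2 : B (K X) (J Y) = -B X (I Y) := by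
      rw [← hB, h.KK, h.KJ, hBl]
    have e3 : B (J X) (K Y) = -B (I X) Y := by
      rw [← hB, h.KK, h.KJ, hBr]
    have e4 : B (J X) (J Y) = B (I X) (I Y) := by rw [← hB, h.KJ, h.KJ]
    have e5 : A (K X) (J Y) = A (I X) Y := by rw [← h.JI, hA]
    have e6 : A (J X) (K Y) = A X (I Y) := by rw [← h.JI, hA]
    simp only [holPart_two_apply, hw, h.IJ, hAl, hAr, hBl, hBr, hA, hB, e1, e2, e3, e4, e5, e6]
    apply Complex.ext
    · simp; ring
    · simp; ring

end Flat

/-! ### The operators ∂_J and ∂∂_J on a vector space. -/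

section FlatOperators

variable {E : Type*} [NormedAddCommGroup E] [NormedSpace ℝ E]

/-- The one-form `∂_J F` on a vector space. -/
noncomputable def flatDelJ (I J : E → E →L[ℝ] E) (F : E → ℝ) (y : E) : E [⋀^Fin 1]→L[ℝ] ℂ :=
  (holPart (-I y) (extDeriv (fun y =>
    ContinuousAlternatingMap.constOfIsEmpty ℝ E (Fin 0) (F y : ℂ)) y)).compContinuousLinearMap (-J y)

/-- The two-form `∂∂_J F` on a vector space. -/
noncomputable def flatHessian (I J : E → E →L[ℝ] E) (F : E → ℝ) (y : E) : E [⋀^Fin 2]→L[ℝ] ℂ :=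
  holPart (I y) (extDeriv (flatDelJ I J F) y)

theorem extDeriv_constOfIsEmpty_apply {F : E → ℝ} {y : E} (hF : DifferentiableAt ℝ F y) (X : E) :
    extDeriv (fun y => ContinuousAlternatingMap.constOfIsEmpty ℝ E (Fin 0) (F y : ℂ)) y ![X] =
      fderiv ℝ F y X := by
  have h1 : HasFDerivAt (fun y => (F y : ℂ)) (Complex.ofRealCLM ∘L fderiv ℝ F y) y :=
    Complex.ofRealCLM.hasFDerivAt.comp y hF.hasFDerivAt
  rw [extDeriv_constOfIsEmpty, h1.fderiv]
  simp

variable {I J K : E → E →L[ℝ] E} {F : E → ℝ} {z : E}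

/-- Smoothness of order ∞ at a point only provides, for each finite k, a neighbourhood on which the
order is k. Order 1 is enough for the derivatives taken at nearby points. -/
theorem eventually_contDiffAt {G : Type*} [NormedAddCommGroup G] [NormedSpace ℝ G] {f : E → G}
    (hf : ContDiffAt ℝ ∞ f z) (k : ℕ) : ∀ᶠ y in 𝓝 z, ContDiffAt ℝ k f y :=
  (hf.of_le (by exact_mod_cast le_top)).eventually (by simp)

/-- Restrict to the line z + tX. A negative second derivative would make the local minimum also a
local maximum, so the restriction would be locally constant and its second derivative zero. -/
theorem second_deriv_nonneg {F : E → ℝ} {z : E} (hF : ContDiffAt ℝ ∞ F z) (hmin : IsLocalMin F z)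
    (X : E) : 0 ≤ fderiv ℝ (fderiv ℝ F) z X X := by
  by_contra! hneg
  have hFd : ∀ᶠ y in 𝓝 z, DifferentiableAt ℝ F y :=
    (eventually_contDiffAt hF 1).mono fun y hy => hy.differentiableAt (by simp)
  have hd : HasFDerivAt (fderiv ℝ F) _ z :=
    ((hF.fderiv_right (m := ∞) le_rfl).differentiableAt (by simp)).hasFDerivAt
  set l : ℝ → E := fun t => z + t • X with hl
  have hl0 : l 0 = z := by simp [hl]
  have hlc : Filter.Tendsto l (𝓝 0) (𝓝 z) := by
    have : Continuous l := by fun_prop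
    simpa [hl0] using this.tendsto 0
  have hld : ∀ t, HasDerivAt l X t := by
    intro t
    simpa only [one_smul, id] using ((hasDerivAt_id t).smul_const X).const_add z
  have hder : ∀ᶠ t in 𝓝 (0 : ℝ), deriv (F ∘ l) t = fderiv ℝ F (l t) X :=
    (hlc.eventually hFd).mono fun t ht =>
      (ht.hasFDerivAt.comp_hasDerivAt t (hld t)).deriv
  have hdd : deriv (deriv (F ∘ l)) 0 = fderiv ℝ (fderiv ℝ F) z X X := by
    have h1 : HasDerivAt (fun t => fderiv ℝ F (l t) X) (fderiv ℝ (fderiv ℝ F) z X X) 0 := by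
      have h2 : HasDerivAt (fun t => fderiv ℝ F (l t)) (fderiv ℝ (fderiv ℝ F) z X) 0 := by
        exact hd.comp_hasDerivAt_of_eq 0 (hld 0) hl0.symm
      simpa using h2.clm_apply (hasDerivAt_const 0 X)
    exact (h1.congr_of_eventuallyEq hder).deriv
  have hmin' : IsLocalMin (F ∘ l) 0 := by
    have := hlc.eventually hmin
    simpa [IsLocalMin, IsMinFilter, hl0] using this
  have hcont : ContinuousAt (F ∘ l) 0 := by
    refine ContinuousAt.comp ?_ (hld 0).continuousAt
    rw [hl0]; exact hF.continuousAt
  have hmax : IsLocalMax (F ∘ l) 0 :=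
    isLocalMax_of_deriv_deriv_neg (by rw [hdd]; exact hneg) hmin'.deriv_eq_zero hcont
  have hconst : F ∘ l =ᶠ[𝓝 0] fun _ => (F ∘ l) 0 := by
    filter_upwards [hmin', hmax] with t h1 h2 using le_antisymm h2 h1
  have : deriv (deriv (F ∘ l)) 0 = 0 := by
    rw [(hconst.deriv).deriv_eq]
    simp
  rw [hdd] at this
  exact hneg.ne this

theorem flatDelJ_apply {y : E} (h : IsQuatTriple (I y) (J y) (K y)) (hF : DifferentiableAt ℝ F y)
    (X : E) : flatDelJ I J F y ![X] =
      2⁻¹ * (-(fderiv ℝ F y (J y X) : ℂ) + Complex.I * (fderiv ℝ F y (K y X) : ℂ)) := by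
  have h0 : (⇑(-J y) ∘ ![X] : Fin 1 → E) = ![-J y X] := by ext i; fin_cases i; rfl
  rw [flatDelJ, ContinuousAlternatingMap.compContinuousLinearMap_apply, h0, holPart_one_apply,
    extDeriv_constOfIsEmpty_apply hF, extDeriv_constOfIsEmpty_apply hF]
  simp [h.IJ]

/-- If the `(2,0)`-part of a two-form vanishes, so does the `(3,0)`-part of its exterior
derivative. -/
theorem holPart_extDeriv_eq_zero {γ : E → E [⋀^Fin 2]→L[ℝ] ℂ} (hI : DifferentiableAt ℝ I z)
    (hnij : ∀ X Y, I z (fderiv ℝ I z X Y - fderiv ℝ I z Y X) =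
      fderiv ℝ I z (I z X) Y - fderiv ℝ I z (I z Y) X)
    (hγ : DifferentiableAt ℝ γ z) (hzero : ∀ᶠ y in 𝓝 z, holPart (I y) (γ y) = 0) :
    holPart (I z) (extDeriv γ z) = 0 := by
  have hpt : ∀ᶠ y in 𝓝 z, ∀ X Y, γ y ![X, Y] - Complex.I * γ y ![I y X, Y]
      - Complex.I * γ y ![X, I y Y] - γ y ![I y X, I y Y] = 0 := by
    filter_upwards [hzero] with y hy X Y
    have h1 := holPart_two_apply (γ y) (I y) X Y
    rw [hy] at h1
    simpa using h1.symm
  -- the derivative of the previous identity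
  have hder : ∀ Z X Y, fderiv ℝ γ z Z ![X, Y] - Complex.I * fderiv ℝ γ z Z ![I z X, Y]
      - Complex.I * fderiv ℝ γ z Z ![X, I z Y] - fderiv ℝ γ z Z ![I z X, I z Y] =
      Complex.I * γ z ![fderiv ℝ I z Z X, Y] + γ z ![fderiv ℝ I z Z X, I z Y]
      - Complex.I * γ z ![fderiv ℝ I z Z Y, X] - γ z ![fderiv ℝ I z Z Y, I z X] := by
    intro Z X Y
    have happ : ∀ (a b : E → E) (a' b' : E →L[ℝ] E), HasFDerivAt a a' z → HasFDerivAt b b' z →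
        ∃ D : E →L[ℝ] ℂ, HasFDerivAt (fun y => γ y ![a y, b y]) D z ∧
          D Z = fderiv ℝ γ z Z ![a z, b z] + γ z ![a' Z, b z] - γ z ![b' Z, a z] := by
      intro a b a' b' ha hb
      have h1 := hγ.hasFDerivAt.continuousAlternatingMap_apply (g := ![a, b]) (g' := ![a', b'])
        (by intro i; fin_cases i; exacts [ha, hb])
      have hfun : ∀ y, (fun i : Fin 2 => (![a, b] : Fin 2 → E → E) i y) = ![a y, b y] := by
        intro y; ext i; fin_cases i <;> rfl
      simp only [hfun] at h1
      refine ⟨_, h1, ?_⟩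
      have u0 : Function.update ![a z, b z] 0 (a' Z) = ![a' Z, b z] := by
        ext i; fin_cases i <;> simp
      have u1 : Function.update ![a z, b z] 1 (b' Z) = ![a z, b' Z] := by
        ext i; fin_cases i <;> simp
      have v0 : (γ z).toContinuousLinearMap ![a z, b z] 0 (a' Z) = γ z ![a' Z, b z] :=
        congrArg (γ z) u0
      have v1 : (γ z).toContinuousLinearMap ![a z, b z] 1 (b' Z) = γ z ![a z, b' Z] :=
        congrArg (γ z) u1
      rw [cform_swap (γ z) (a z) (b' Z), sub_neg_eq_add, ← v0, ← v1]
      simp [Fin.sum_univ_two, add_assoc]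
    have hIX : ∀ X, HasFDerivAt (fun y => I y X) ((fderiv ℝ I z).flip X) z := by
      intro X
      simpa using hI.hasFDerivAt.clm_apply (hasFDerivAt_const X z)
    obtain ⟨D1, h1, e1⟩ := happ (fun _ => X) (fun _ => Y) _ _ (hasFDerivAt_const X z)
      (hasFDerivAt_const Y z)
    obtain ⟨D2, h2, e2⟩ := happ (fun y => I y X) (fun _ => Y) _ _ (hIX X) (hasFDerivAt_const Y z)
    obtain ⟨D3, h3, e3⟩ := happ (fun _ => X) (fun y => I y Y) _ _ (hasFDerivAt_const X z) (hIX Y)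
    obtain ⟨D4, h4, e4⟩ := happ (fun y => I y X) (fun y => I y Y) _ _ (hIX X) (hIX Y)
    have h5 := ((h1.sub (h2.const_mul Complex.I)).sub (h3.const_mul Complex.I)).sub h4
    have h6 := h5.unique ((hasFDerivAt_const (0 : ℂ) z).congr_of_eventuallyEq
      (hpt.mono fun y hy => hy X Y))
    have h7 := congrArg (fun f : E →L[ℝ] ℂ => f Z) h6
    have z0 : ∀ W, γ z ![0, W] = 0 := fun W => by simpa using cform_smul_left (γ z) 0 0 W
    simp only [_root_.sub_apply, _root_.smul_apply, smul_eq_mul, e1, e2, e3, e4,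
      _root_.zero_apply, z0, ContinuousLinearMap.flip_apply] at h7
    linear_combination h7
  -- These are the terms containing derivatives of `I`, antisymmetrised in X and Y. With V = DI_X Y
  -- - DI_Y X, the Nijenhuis identity gives IV = DI_{IX} Y - DI_{IY} X, and the sum becomes a
  -- multiple of the vanishing (2,0)-part of γ at (V, Z).
  have hQ : ∀ X Y Z, (Complex.I * γ z ![fderiv ℝ I z X Y, Z] + γ z ![fderiv ℝ I z X Y, I z Z])
      - (Complex.I * γ z ![fderiv ℝ I z Y X, Z] + γ z ![fderiv ℝ I z Y X, I z Z])
      - Complex.I * ((Complex.I * γ z ![fderiv ℝ I z (I z X) Y, Z] +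
          γ z ![fderiv ℝ I z (I z X) Y, I z Z])
        - (Complex.I * γ z ![fderiv ℝ I z (I z Y) X, Z] +
          γ z ![fderiv ℝ I z (I z Y) X, I z Z])) = 0 := by
    intro X Y Z
    have h1 := hpt.self_of_nhds (fderiv ℝ I z X Y - fderiv ℝ I z Y X) Z
    rw [hnij] at h1
    simp only [cform_sub_left] at h1
    linear_combination Complex.I * h1 + (γ z ![fderiv ℝ I z X Y, I z Z]
      - γ z ![fderiv ℝ I z Y X, I z Z]) * Complex.I_sq
  ext v
  have hv : v = ![v 0, v 1, v 2] := by ext j; fin_cases j <;> rfl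
  rw [hv, holPart_three_apply]
  simp only [extDeriv_three_apply]
  generalize v 0 = X, v 1 = Y, v 2 = Z
  refine mul_eq_zero_of_right _ ?_
  -- The (3,0)-part of dγ is the alternating sum of `hder` along X - √-1 XI, Y - √-1 YI and Z - √-1
  -- ZI. The remaining terms group into three instances of `hQ`.
  linear_combination hder X Y Z - Complex.I * hder (I z X) Y Z - hder Y X Z
    + Complex.I * hder (I z Y) X Z + hder Z X Y - Complex.I * hder (I z Z) X Y
    + hQ X Y Z + hQ Y Z X - hQ X Z Y
    + (fderiv ℝ γ z (I z Y) ![I z X, Z] - fderiv ℝ γ z (I z X) ![I z Y, Z]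
      - fderiv ℝ γ z (I z X) ![Y, I z Z] - fderiv ℝ γ z (I z Z) ![I z X, Y]
      + fderiv ℝ γ z (I z Y) ![X, I z Z] - fderiv ℝ γ z (I z Z) ![X, I z Y]) * Complex.I_sq

variable [FiniteDimensional ℝ E]

theorem contDiffAt_flatDelJ (hI : ContDiffAt ℝ ∞ I z) (hJ : ContDiffAt ℝ ∞ J z)
    (hF : ContDiffAt ℝ ∞ F z) : ContDiffAt ℝ ∞ (flatDelJ I J F) z := by
  refine contDiffAt_comp_form (contDiffAt_holPart (contDiffAt_extDeriv ?_) hI.neg) hJ.neg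
  exact contDiffAt_form fun v => Complex.ofRealCLM.contDiff.contDiffAt.comp z hF

theorem contDiffAt_flatHessian (hI : ContDiffAt ℝ ∞ I z) (hJ : ContDiffAt ℝ ∞ J z)
    (hF : ContDiffAt ℝ ∞ F z) : ContDiffAt ℝ ∞ (flatHessian I J F) z :=
  contDiffAt_holPart (contDiffAt_extDeriv (contDiffAt_flatDelJ hI hJ hF)) hI

/-- By `flatDelJ_apply`, ∂_J F is half of -dF ∘ J + √-1 dF ∘ K near `z`; the product rule then gives
the two twists. -/
theorem extDeriv_flatDelJ (h : IsHypercomplexAt I J K z) (hF : ContDiffAt ℝ ∞ F z) (X Y : E) :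
    extDeriv (flatDelJ I J F) z ![X, Y] =
      2⁻¹ * (-(twist F J z X Y : ℂ) + Complex.I * (twist F K z X Y : ℂ)) := by
  have hθ := (contDiffAt_flatDelJ h.smooth_I h.smooth_J hF).differentiableAt (by simp)
  have hd : HasFDerivAt (fderiv ℝ F) _ z :=
    ((hF.fderiv_right (m := ∞) le_rfl).differentiableAt (by simp)).hasFDerivAt
  have hJ := (h.smooth_J.differentiableAt (by simp)).hasFDerivAt
  have hK := (h.smooth_K.differentiableAt (by simp)).hasFDerivAt
  have hFd : ∀ᶠ y in 𝓝 z, DifferentiableAt ℝ F y :=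
    (eventually_contDiffAt hF 1).mono fun y hy => hy.differentiableAt (by simp)
  have key : ∀ W Z : E, fderiv ℝ (fun y => flatDelJ I J F y ![W]) z Z =
      2⁻¹ * (-((fderiv ℝ (fderiv ℝ F) z Z (J z W) + fderiv ℝ F z (fderiv ℝ J z Z W) : ℝ) : ℂ) +
        Complex.I * ((fderiv ℝ (fderiv ℝ F) z Z (K z W) + fderiv ℝ F z (fderiv ℝ K z Z W) : ℝ) : ℂ))
      := by
    intro W Z
    have h1 : HasFDerivAt (fun y => fderiv ℝ F y (J y W)) _ z :=
      hd.clm_apply (hJ.clm_apply (hasFDerivAt_const W z))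
    have h2 : HasFDerivAt (fun y => fderiv ℝ F y (K y W)) _ z :=
      hd.clm_apply (hK.clm_apply (hasFDerivAt_const W z))
    have h3 := ((Complex.ofRealCLM.hasFDerivAt.comp z h1).neg.add
      ((Complex.ofRealCLM.hasFDerivAt.comp z h2).const_mul Complex.I)).const_mul (2⁻¹ : ℂ)
    have h4 := h3.congr_of_eventuallyEq (f₁ := fun y => flatDelJ I J F y ![W])
      ((h.triple.and hFd).mono fun y hy => flatDelJ_apply hy.1 hy.2 W)
    rw [h4.fderiv]
    simp
    ring
  rw [extDeriv_two_apply hθ, key, key]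
  simp only [twist, map_sub]
  push_cast
  ring

/-- `∂∂_J F` is q-real. -/
theorem flatHessian_mem_qReal20 (h : IsHypercomplexAt I J K z) (hF : ContDiffAt ℝ ∞ F z) :
    flatHessian I J F z ∈ qReal20 (I z) (J z) :=
  holPart_mem_qReal20 h.triple.self_of_nhds
    (twist_invariant hF (h.smooth_J.differentiableAt (by simp)) (h.triple.mono fun _ hy => hy.JJ)
      h.nij_J)
    (twist_invariant hF (h.smooth_K.differentiableAt (by simp)) (h.triple.mono fun _ hy => hy.KK)
      h.nij_K)
    (extDeriv_flatDelJ h hF) (twist_neg_left F J z) (twist_neg_right F J z) (twist_neg_left F K z)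
    (twist_neg_right F K z)

/-- At a critical point, `∂∂_J F` is the quaternionic average of the Hessian. -/
theorem metricOf_flatHessian_of_critical (h : IsHypercomplexAt I J K z) (hF : ContDiffAt ℝ ∞ F z)
    (hcrit : fderiv ℝ F z = 0) (X : E) :
    metricOf (J z) (flatHessian I J F z) X X = 4⁻¹ * (fderiv ℝ (fderiv ℝ F) z X X +
      fderiv ℝ (fderiv ℝ F) z (I z X) (I z X) + fderiv ℝ (fderiv ℝ F) z (J z X) (J z X) +
      fderiv ℝ (fderiv ℝ F) z (K z X) (K z X)) := by
  have hz := h.triple.self_of_nhds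
  rw [metricOf_apply, flatHessian, holPart_two_apply]
  simp only [extDeriv_flatDelJ h hF, twist, hcrit, hz.JJ, hz.KJ, hz.IJ, hz.JI, hz.KI, hz.JK, hz.KK,
    map_neg, _root_.neg_apply, _root_.zero_apply]
  simp
  ring

/-- `∂∂(∂_J F) = 0`. -/
theorem holPart_extDeriv_flatHessian (h : IsHypercomplexAt I J K z) (hF : ContDiffAt ℝ ∞ F z) :
    holPart (I z) (extDeriv (flatHessian I J F) z) = 0 := by
  have hθ := contDiffAt_flatDelJ h.smooth_I h.smooth_J hF
  have h1 := (contDiffAt_extDeriv hθ).differentiableAt (by simp)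
  have h2 := (contDiffAt_flatHessian h.smooth_I h.smooth_J hF).differentiableAt (by simp)
  -- Let ω = d(∂_J F), so that ∂∂_J F is its (2,0)-part. Since dω = 0, the derivative of ∂∂_J F is
  -- minus that of ω - ∂∂_J F, a form with no (2,0)-part.
  have h3 : extDeriv (flatHessian I J F) z =
      -extDeriv (extDeriv (flatDelJ I J F) + (-1 : ℝ) • flatHessian I J F) z := by
    rw [extDeriv_add h1 (h2.const_smul _), extDeriv_smul,
      extDeriv_extDeriv_apply (r := ∞) hθ (by simp; exact WithTop.coe_le_coe.mpr le_top)]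
    simp
  have h4 := holPart_extDeriv_eq_zero (γ := extDeriv (flatDelJ I J F) + (-1 : ℝ) • flatHessian I J F)
    (h.smooth_I.differentiableAt (by simp)) h.nij_I (h1.add (h2.const_smul _)) (by
      filter_upwards [h.triple] with y hy
      change holPart (I y) (extDeriv (flatDelJ I J F) y + (-1 : ℝ) • flatHessian I J F y) = 0
      rw [holPart_add, holPart_smul, flatHessian, holPart_two_idem _ _ hy.II]
      exact (congrArg (_ + ·) (neg_one_smul ℝ _)).trans (add_neg_cancel _))
  rw [h3, ← neg_one_smul ℝ, holPart_smul, h4]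
  ext v
  exact smul_zero (-1 : ℝ)

end FlatOperators

/-! ## Forms and endomorphism fields in charts -/

section Charts

variable {n : ℕ} {M : Type*} [TopologicalSpace M] [ChartedSpace (Model n) M]
  [IsManifold 𝓘(ℝ, Model n) ∞ M]

/-- The coordinates of tangent vectors at `p` in the chart around `x`. -/
noncomputable def toCoord (x p : M) : TangentSpace 𝓘(ℝ, Model n) p →L[ℝ] Model n :=
  (trivializationAt (Model n) (TangentSpace 𝓘(ℝ, Model n)) x).continuousLinearMapAt ℝ p

/-- The tangent vector at `p` with given coordinates in the chart around `x`. -/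
noncomputable def ofCoord (x p : M) : Model n →L[ℝ] TangentSpace 𝓘(ℝ, Model n) p :=
  (trivializationAt (Model n) (TangentSpace 𝓘(ℝ, Model n)) x).symmL ℝ p

variable {x p : M}

theorem toCoord_ofCoord (hp : p ∈ (chartAt (Model n) x).source) (v : Model n) :
    toCoord x p (ofCoord x p v) = v :=
  Bundle.Trivialization.continuousLinearMapAt_symmL _ (by simpa using hp) v

theorem ofCoord_toCoord (hp : p ∈ (chartAt (Model n) x).source)
    (v : TangentSpace 𝓘(ℝ, Model n) p) : ofCoord x p (toCoord x p v) = v :=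
  Bundle.Trivialization.symmL_continuousLinearMapAt _ (by simpa using hp) v

/-- The tangent space at `x` is the model space, identified through the preferred chart at `x`; at
the centre of a chart no change of coordinates is therefore needed. -/
theorem toCoord_self (v : TangentSpace 𝓘(ℝ, Model n) x) : toCoord x x v = v := by
  have h1 : toCoord x x = mfderiv 𝓘(ℝ, Model n) 𝓘(ℝ, Model n) (extChartAt 𝓘(ℝ, Model n) x) x :=
    TangentBundle.continuousLinearMapAt_trivializationAt (mem_chart_source _ x)
  have h2 := mfderiv_extChartAt_self (I := 𝓘(ℝ, Model n)) (x := x)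
  exact congrArg (fun f : Model n →L[ℝ] Model n => f v) (h1.trans h2)

theorem mfderiv_extChartAt_eq (hp : p ∈ (chartAt (Model n) x).source) :
    (mfderiv 𝓘(ℝ, Model n) 𝓘(ℝ, Model n) (extChartAt 𝓘(ℝ, Model n) x) p :
      TangentSpace 𝓘(ℝ, Model n) p →L[ℝ] Model n) = toCoord x p := by
  exact (TangentBundle.continuousLinearMapAt_trivializationAt hp).symm

theorem mfderiv_extChartAt_symm_eq (hp : p ∈ (chartAt (Model n) x).source) :
    (mfderiv 𝓘(ℝ, Model n) 𝓘(ℝ, Model n) (extChartAt 𝓘(ℝ, Model n) x).symm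
      (extChartAt 𝓘(ℝ, Model n) x p) : Model n →L[ℝ] Model n) = ofCoord x p := by
  refine Eq.trans ?_ (TangentBundle.symmL_trivializationAt hp).symm
  simp only [modelWithCornersSelf_coe, Set.range_id, mfderivWithin_univ]

theorem fderiv_transition {x' : M} (hp : p ∈ (chartAt (Model n) x).source)
    (hp' : p ∈ (chartAt (Model n) x').source) (v : Model n) :
    fderiv ℝ (extChartAt 𝓘(ℝ, Model n) x' ∘ (extChartAt 𝓘(ℝ, Model n) x).symm)
      (extChartAt 𝓘(ℝ, Model n) x p) v = toCoord x' p (ofCoord x p v) := by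
  have h1 := tangentCoordChange_def (I := 𝓘(ℝ, Model n)) (x := x) (y := x') (z := p)
  simp only [modelWithCornersSelf_coe, Set.range_id, fderivWithin_univ] at h1
  rw [← h1]
  have h2 : toCoord x' p = tangentCoordChange 𝓘(ℝ, Model n) p x' p :=
    TangentBundle.continuousLinearMapAt_trivializationAt_eq_core hp'
  have h3 : ofCoord x p = tangentCoordChange 𝓘(ℝ, Model n) x p p :=
    TangentBundle.symmL_trivializationAt_eq_core hp
  have h4 := tangentCoordChange_comp (I := 𝓘(ℝ, Model n)) (w := x) (x := p) (y := x') (z := p)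
    (v := v) (by simp [hp, hp'])
  rw [← h4]
  exact (congrArg₂ (fun (f g : Model n →L[ℝ] Model n) => f (g v)) h2 h3).symm

variable {k : ℕ}

theorem inChart_extChartAt (α : Form n M k) (hp : p ∈ (chartAt (Model n) x).source) :
    Form.inChart α x (extChartAt 𝓘(ℝ, Model n) x p) =
      (α p).compContinuousLinearMap (ofCoord x p) := by
  have h1 : (extChartAt 𝓘(ℝ, Model n) x).symm (extChartAt 𝓘(ℝ, Model n) x p) = p :=
    (extChartAt 𝓘(ℝ, Model n) x).left_inv (by simpa using hp)
  have h2 := mfderiv_extChartAt_symm_eq hp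
  -- The base point occurs in the type of the form, so it is freed together with the linear map and
  -- both equalities are substituted at once.
  have key : ∀ (q : M) (L : Model n →L[ℝ] Model n), q = p → L = ofCoord x p →
      (ContinuousAlternatingMap.compContinuousLinearMap (α q) L : Model n [⋀^Fin k]→L[ℝ] ℂ) =
        (α p).compContinuousLinearMap (ofCoord x p) := by
    rintro q L rfl rfl; rfl
  exact key _ _ h1 h2

theorem form_d_eq (α : Form n M k) (x : M) : Form.d α x =
    (extDeriv (Form.inChart α x) (extChartAt 𝓘(ℝ, Model n) x x)).compContinuousLinearMap
      (toCoord x x) := by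
  rw [← mfderiv_extChartAt_eq (mem_chart_source _ x)]
  rfl

/-- The exterior derivative may be computed in any chart. -/
theorem inChart_d (α : Form n M k) (hp : p ∈ (chartAt (Model n) x).source)
    (hα : DifferentiableAt ℝ (Form.inChart α x) (extChartAt 𝓘(ℝ, Model n) x p)) :
    Form.inChart (Form.d α) x (extChartAt 𝓘(ℝ, Model n) x p) =
      extDeriv (Form.inChart α x) (extChartAt 𝓘(ℝ, Model n) x p) := by
  set e := extChartAt 𝓘(ℝ, Model n) x
  set e' := extChartAt 𝓘(ℝ, Model n) p
  have hτp : (e ∘ e'.symm) (e' p) = e p := by simp [e, e']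
  -- Near `p`, the form in the chart around `p` is the pullback, by the transition map, of the form
  -- in the chart around `x`. The claim is then naturality of the exterior derivative.
  have hev : Form.inChart α p =ᶠ[𝓝 (e' p)] fun w =>
      (Form.inChart α x ((e ∘ e'.symm) w)).compContinuousLinearMap
        (fderiv ℝ (e ∘ e'.symm) w) := by
    have h1 : ∀ᶠ w in 𝓝 (e' p), w ∈ e'.target :=
      extChartAt_target_mem_nhds p
    have h2 : ∀ᶠ w in 𝓝 (e' p), e'.symm w ∈ (chartAt (Model n) x).source := by
      refine (continuousAt_extChartAt_symm p).eventually ?_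
      rw [extChartAt_to_inv]
      exact (chartAt (Model n) x).open_source.mem_nhds hp
    filter_upwards [h1, h2] with w hw1 hw2
    have h3 : e' (e'.symm w) = w := e'.right_inv hw1
    have h4 : e'.symm w ∈ (chartAt (Model n) p).source := by
      simpa [e'] using e'.map_target hw1
    generalize e'.symm w = q at h3 h4 hw2
    subst h3
    have hτq : (e ∘ e'.symm) (e' q) = e q := by
      simp only [Function.comp_apply]
      rw [e'.left_inv (by simpa [e'] using h4)]
    rw [inChart_extChartAt _ h4, hτq, inChart_extChartAt _ hw2]
    ext v
    simp only [ContinuousAlternatingMap.compContinuousLinearMap_apply]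
    congr 1
    ext1 i
    simp only [Function.comp_apply]
    rw [fderiv_transition h4 hw2, ofCoord_toCoord hw2]
  have hsm : ContDiffAt ℝ ∞ (e ∘ e'.symm) (e' p) := by
    have h1 := contDiffWithinAt_ext_coord_change (I := 𝓘(ℝ, Model n)) (n := ∞) x p (y := e' p)
      (by simp [e', hp])
    simpa only [modelWithCornersSelf_coe, Set.range_id, contDiffWithinAt_univ] using h1
  rw [inChart_extChartAt _ hp, form_d_eq, hev.extDeriv_eq,
    extDeriv_pullback (r := ∞) (by rw [hτp]; exact hα) hsm
      (by simp; exact WithTop.coe_le_coe.mpr le_top), hτp]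
  ext v
  simp only [ContinuousAlternatingMap.compContinuousLinearMap_apply]
  congr 1
  ext1 i
  simp only [Function.comp_apply]
  rw [fderiv_transition (mem_chart_source _ p) hp, ofCoord_toCoord (mem_chart_source _ p),
    toCoord_ofCoord hp]

end Charts

/-! ### Complex structures, metrics and Lie brackets in coordinates. -/

section ChartEndomorphisms

/-- A property which holds at all points near the centre of a chart, in coordinates. -/
theorem eventually_extChartAt {n : ℕ} {M : Type*} [TopologicalSpace M]
    [ChartedSpace (Model n) M] {x : M} {P : Model n → Prop}
    (h : ∀ᶠ q in 𝓝 x, q ∈ (chartAt (Model n) x).source → P (extChartAt 𝓘(ℝ, Model n) x q)) :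
    ∀ᶠ z in 𝓝 (extChartAt 𝓘(ℝ, Model n) x x), P z := by
  have h1 : ∀ᶠ z in 𝓝 (extChartAt 𝓘(ℝ, Model n) x x), z ∈ (extChartAt 𝓘(ℝ, Model n) x).target :=
    extChartAt_target_mem_nhds x
  have h2 : Filter.Tendsto (extChartAt 𝓘(ℝ, Model n) x).symm (𝓝 (extChartAt 𝓘(ℝ, Model n) x x))
      (𝓝 x) := by
    have := continuousAt_extChartAt_symm (I := 𝓘(ℝ, Model n)) x
    rwa [ContinuousAt, extChartAt_to_inv] at this
  filter_upwards [h1, h2.eventually h] with z hz1 hz2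
  rw [← (extChartAt 𝓘(ℝ, Model n) x).right_inv hz1]
  exact hz2 (by simpa using (extChartAt 𝓘(ℝ, Model n) x).map_target hz1)

variable {n : ℕ} {M : Type*} [TopologicalSpace M] [ChartedSpace (Model n) M]
  [IsManifold 𝓘(ℝ, Model n) ∞ M] {x p : M}

/-- An endomorphism field read in the chart around `x`. -/
noncomputable def coordEnd (A : EndField n M) (x : M) (z : Model n) : Model n →L[ℝ] Model n :=
  toCoord x ((extChartAt 𝓘(ℝ, Model n) x).symm z) ∘L A ((extChartAt 𝓘(ℝ, Model n) x).symm z) ∘L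
    ofCoord x ((extChartAt 𝓘(ℝ, Model n) x).symm z)

theorem coordEnd_extChartAt (A : EndField n M) (hp : p ∈ (chartAt (Model n) x).source) :
    coordEnd A x (extChartAt 𝓘(ℝ, Model n) x p) = toCoord x p ∘L A p ∘L ofCoord x p := by
  have h1 : (extChartAt 𝓘(ℝ, Model n) x).symm (extChartAt 𝓘(ℝ, Model n) x p) = p :=
    (extChartAt 𝓘(ℝ, Model n) x).left_inv (by simpa using hp)
  rw [coordEnd, h1]

theorem ofCoord_coordEnd (A : EndField n M) (hp : p ∈ (chartAt (Model n) x).source)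
    (v : Model n) :
    ofCoord x p (coordEnd A x (extChartAt 𝓘(ℝ, Model n) x p) v) = A p (ofCoord x p v) := by
  rw [coordEnd_extChartAt A hp]
  exact ofCoord_toCoord hp _

theorem contDiffAt_comp_symm {G : Type*} [NormedAddCommGroup G] [NormedSpace ℝ G] {f : M → G}
    (hf : ContMDiffAt 𝓘(ℝ, Model n) 𝓘(ℝ, G) ∞ f x) :
    ContDiffAt ℝ ∞ (fun z => f ((extChartAt 𝓘(ℝ, Model n) x).symm z))
      (extChartAt 𝓘(ℝ, Model n) x x) := by
  have h1 : ContMDiffAt 𝓘(ℝ, Model n) 𝓘(ℝ, Model n) ∞ (extChartAt 𝓘(ℝ, Model n) x).symm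
      (extChartAt 𝓘(ℝ, Model n) x x) :=
    (contMDiffOn_extChartAt_symm x).contMDiffAt (extChartAt_target_mem_nhds x)
  exact (ContMDiffAt.comp_of_eq hf h1 (extChartAt_to_inv x)).contDiffAt

theorem contDiffAt_of_contMDiffAt {G : Type*} [NormedAddCommGroup G] [NormedSpace ℝ G] {f : M → G}
    {F : Model n → G} (hf : ContMDiffAt 𝓘(ℝ, Model n) 𝓘(ℝ, G) ∞ f x)
    (hF : ∀ q ∈ (chartAt (Model n) x).source, F (extChartAt 𝓘(ℝ, Model n) x q) = f q) :
    ContDiffAt ℝ ∞ F (extChartAt 𝓘(ℝ, Model n) x x) := by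
  refine (contDiffAt_comp_symm hf).congr_of_eventuallyEq (eventually_extChartAt ?_)
  refine Filter.Eventually.of_forall fun q hq => ?_
  rw [hF q hq]
  exact congrArg f ((extChartAt 𝓘(ℝ, Model n) x).left_inv (by simpa using hq)).symm

theorem contDiffAt_coordEnd {A : EndField n M} (hA : IsComplexStructure A) (x : M) :
    ContDiffAt ℝ ∞ (coordEnd A x) (extChartAt 𝓘(ℝ, Model n) x x) := by
  have h1 := ((contMDiffAt_hom_bundle _).mp (hA.contMDiff x)).2
  have h2 : ContMDiffAt 𝓘(ℝ, Model n) 𝓘(ℝ, Model n →L[ℝ] Model n) ∞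
    (fun p => toCoord x p ∘L A p ∘L ofCoord x p) x := h1
  exact contDiffAt_of_contMDiffAt h2 fun q hq => coordEnd_extChartAt A hq

/-- The local vector field with constant coordinates is smooth. -/
theorem contMDiffAt_ofCoord (x : M) (v : Model n) :
    ContMDiffAt 𝓘(ℝ, Model n) 𝓘(ℝ, Model n).tangent ∞
      (fun y => (⟨y, ofCoord x y v⟩ : TangentBundle 𝓘(ℝ, Model n) M)) x := by
  refine (Bundle.contMDiffAt_section x).mpr ?_
  refine (contMDiffAt_const (c := v)).congr_of_eventuallyEq ?_
  filter_upwards [(chartAt (Model n) x).open_source.mem_nhds (mem_chart_source _ x)] with y hy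
  have h1 := toCoord_ofCoord hy v
  have hy' : y ∈ (trivializationAt (Model n) (TangentSpace 𝓘(ℝ, Model n)) x).baseSet := by
    simpa using hy
  exact (congrFun (Bundle.Trivialization.coe_linearMapAt_of_mem _ hy') _).symm.trans h1

theorem contMDiffAt_app {A : EndField n M} (hA : IsComplexStructure A)
    {X : (y : M) → TangentSpace 𝓘(ℝ, Model n) y}
    (hX : ContMDiffAt 𝓘(ℝ, Model n) 𝓘(ℝ, Model n).tangent ∞
      (fun y => (⟨y, X y⟩ : TangentBundle 𝓘(ℝ, Model n) M)) x) :
    ContMDiffAt 𝓘(ℝ, Model n) 𝓘(ℝ, Model n).tangent ∞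
      (fun y => (⟨y, A y (X y)⟩ : TangentBundle 𝓘(ℝ, Model n) M)) x :=
  ContMDiffAt.clm_bundle_apply (hA.contMDiff x) hX

theorem contMDiffAt_metric (g : Metric n M)
    {X Y : (y : M) → TangentSpace 𝓘(ℝ, Model n) y}
    (hX : ContMDiffAt 𝓘(ℝ, Model n) 𝓘(ℝ, Model n).tangent ∞
      (fun y => (⟨y, X y⟩ : TangentBundle 𝓘(ℝ, Model n) M)) x)
    (hY : ContMDiffAt 𝓘(ℝ, Model n) 𝓘(ℝ, Model n).tangent ∞
      (fun y => (⟨y, Y y⟩ : TangentBundle 𝓘(ℝ, Model n) M)) x) :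
    ContMDiffAt 𝓘(ℝ, Model n) 𝓘(ℝ, ℝ) ∞ (fun y => g.inner y (X y) (Y y)) x := by
  have h1 := ContMDiffAt.clm_bundle_apply₂ (F₃ := ℝ) (E₃ := Bundle.Trivial M ℝ)
    (g.contMDiff x) hX hY
  exact ((Bundle.contMDiffAt_section x).mp h1)

/-- The bracket at `x` is that of the pullbacks to the preferred chart. Near the centre these
pullbacks are `v` and `w`, and the derivative of the chart at its centre is the identity. -/
theorem mlieBracket_eq_ofCoord {V W : (y : M) → TangentSpace 𝓘(ℝ, Model n) y}
    {v w : Model n → Model n}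
    (hV : ∀ q ∈ (chartAt (Model n) x).source,
      V q = ofCoord x q (v (extChartAt 𝓘(ℝ, Model n) x q)))
    (hW : ∀ q ∈ (chartAt (Model n) x).source,
      W q = ofCoord x q (w (extChartAt 𝓘(ℝ, Model n) x q))) :
    (VectorField.mlieBracket 𝓘(ℝ, Model n) V W x : Model n) =
      VectorField.lieBracket ℝ v w (extChartAt 𝓘(ℝ, Model n) x x) := by
  have hpull : ∀ {V : (y : M) → TangentSpace 𝓘(ℝ, Model n) y} {v : Model n → Model n},
      (∀ q ∈ (chartAt (Model n) x).source,
        V q = ofCoord x q (v (extChartAt 𝓘(ℝ, Model n) x q))) →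
      (VectorField.mpullback 𝓘(ℝ, Model n) 𝓘(ℝ, Model n) (extChartAt 𝓘(ℝ, Model n) x).symm V :
        Model n → Model n) =ᶠ[𝓝 (extChartAt 𝓘(ℝ, Model n) x x)] v := by
    intro V v hV
    refine eventually_extChartAt (Filter.Eventually.of_forall fun q hq => ?_)
    have h1 : (extChartAt 𝓘(ℝ, Model n) x).symm (extChartAt 𝓘(ℝ, Model n) x q) = q :=
      (extChartAt 𝓘(ℝ, Model n) x).left_inv (by simpa using hq)
    have key : ∀ (r : M) (L : Model n →L[ℝ] Model n), r = q → L = ofCoord x q →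
        L.inverse (V r) = v (extChartAt 𝓘(ℝ, Model n) x q) := by
      rintro r L rfl rfl
      rw [hV r hq]
      have hinv : (ofCoord x r : Model n →L[ℝ] TangentSpace 𝓘(ℝ, Model n) r).inverse = toCoord x r := by
        refine ContinuousLinearMap.inverse_eq ?_ ?_
        · ext1 u; exact ofCoord_toCoord hq u
        · ext1 u; exact toCoord_ofCoord hq u
      exact (congrArg (fun f : TangentSpace 𝓘(ℝ, Model n) r →L[ℝ] Model n => f _) hinv).trans
        (toCoord_ofCoord hq _)
    exact key _ _ h1 (mfderiv_extChartAt_symm_eq hq)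
  have h2 := (hpull hV).lieBracket_vectorField_eq (𝕜 := ℝ) (hpull hW)
  have h3 : (VectorField.mlieBracket 𝓘(ℝ, Model n) V W x : Model n) =
    (mfderiv 𝓘(ℝ, Model n) 𝓘(ℝ, Model n) (extChartAt 𝓘(ℝ, Model n) x) x).inverse
      (VectorField.lieBracket ℝ (E := Model n)
        (VectorField.mpullback 𝓘(ℝ, Model n) 𝓘(ℝ, Model n) (extChartAt 𝓘(ℝ, Model n) x).symm V :
          Model n → Model n)
        (VectorField.mpullback 𝓘(ℝ, Model n) 𝓘(ℝ, Model n) (extChartAt 𝓘(ℝ, Model n) x).symm W :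
          Model n → Model n) (extChartAt 𝓘(ℝ, Model n) x x)) := by
    rw [← VectorField.mlieBracketWithin_univ, VectorField.mlieBracketWithin_apply]
    simp only [modelWithCornersSelf_coe, Set.range_id, Set.preimage_univ, Set.univ_inter,
      VectorField.mpullbackWithin_univ]
    exact congrArg (fun u : Model n => ContinuousLinearMap.inverse (mfderiv 𝓘(ℝ, Model n)
      𝓘(ℝ, Model n) (extChartAt 𝓘(ℝ, Model n) x) x) u)
      (congrFun VectorField.lieBracketWithin_univ _)
  rw [h3, h2, mfderiv_extChartAt_self]
  exact congrArg (fun f : Model n →L[ℝ] Model n => f _) ContinuousLinearMap.inverse_id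

/-- The vanishing of the Nijenhuis tensor, in coordinates. -/
theorem nijenhuis_coordEnd {A : EndField n M} (hA : IsComplexStructure A) (x : M)
    (X Y : Model n) :
    letI L := coordEnd A x
    letI z := extChartAt 𝓘(ℝ, Model n) x x
    L z (fderiv ℝ L z X Y - fderiv ℝ L z Y X) =
      fderiv ℝ L z (L z X) Y - fderiv ℝ L z (L z Y) X := by
  set L := coordEnd A x with hLdef
  set z := extChartAt 𝓘(ℝ, Model n) x x with hz
  have hL : DifferentiableAt ℝ L z := (contDiffAt_coordEnd hA x).differentiableAt (by simp)
  have hLd : ∀ Z, HasFDerivAt (fun y => L y Z) ((fderiv ℝ L z).flip Z) z := by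
    intro Z
    simpa using hL.hasFDerivAt.clm_apply (hasFDerivAt_const Z z)
  have hc : ∀ Z : Model n, ∀ q ∈ (chartAt (Model n) x).source, ofCoord x q Z =
      ofCoord x q ((fun _ => Z) (extChartAt 𝓘(ℝ, Model n) x q)) := fun _ _ _ => rfl
  have ha : ∀ Z : Model n, ∀ q ∈ (chartAt (Model n) x).source,
      A.app (fun q => ofCoord x q Z) q =
      ofCoord x q ((fun y => L y Z) (extChartAt 𝓘(ℝ, Model n) x q)) := fun Z q hq =>
    (ofCoord_coordEnd A hq Z).symm
  have hAx : ∀ v : Model n, (A x v : Model n) = L z v := by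
    intro v
    have h1 := ofCoord_coordEnd A (mem_chart_source (Model n) x) (x := x) v
    have h2 : ∀ u : Model n, (ofCoord x x u : Model n) = u := fun u =>
      (toCoord_self (ofCoord x x u)).symm.trans (toCoord_ofCoord (mem_chart_source _ x) u)
    have h3 := (h2 _).symm.trans (h1.trans (congrArg (A x) (h2 v)))
    exact h3.symm
  -- The tensor is tested on fields with constant coordinates: their own bracket vanishes, and the
  -- three other brackets produce only derivatives of `L`.
  have hN := hA.integrable x (fun q => ofCoord x q X) (fun q => ofCoord x q Y)
    (contMDiffAt_ofCoord x X) (contMDiffAt_ofCoord x Y)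
  have e1 := mlieBracket_eq_ofCoord (x := x) (V := fun q => ofCoord x q X) (W := fun q => ofCoord x q Y)
    (v := fun _ => X) (w := fun _ => Y) (hc X) (hc Y)
  have e2 := mlieBracket_eq_ofCoord (x := x) (V := A.app fun q => ofCoord x q X) (W := fun q => ofCoord x q Y)
    (v := fun y => L y X) (w := fun _ => Y) (ha X) (hc Y)
  have e3 := mlieBracket_eq_ofCoord (x := x) (V := fun q => ofCoord x q X) (W := A.app fun q => ofCoord x q Y)
    (v := fun _ => X) (w := fun y => L y Y) (hc X) (ha Y)
  have e4 := mlieBracket_eq_ofCoord (x := x) (V := A.app fun q => ofCoord x q X) (W := A.app fun q => ofCoord x q Y)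
    (v := fun y => L y X) (w := fun y => L y Y) (ha X) (ha Y)
  have hN' : VectorField.lieBracket ℝ (fun _ => X) (fun _ => Y) z
      + L z (VectorField.lieBracket ℝ (fun y => L y X) (fun _ => Y) z)
      + L z (VectorField.lieBracket ℝ (fun _ => X) (fun y => L y Y) z)
      - VectorField.lieBracket ℝ (fun y => L y X) (fun y => L y Y) z = 0 := by
    have key : ∀ B : Model n → Model n, (∀ v, B v = L z v) → ∀ a₁ a₂ a₃ a₄ : Model n,
        a₁ + B a₂ + B a₃ - a₄ = 0 → a₁ + L z a₂ + L z a₃ - a₄ = 0 := by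
      intro B hB a₁ a₂ a₃ a₄ h
      rwa [hB, hB] at h
    have h5 := key (fun v => A x v) hAx _ _ _ _ hN
    rw [e1, e2, e3, e4] at h5
    exact h5
  simp only [VectorField.lieBracket, (hLd _).fderiv, fderiv_fun_const, Pi.zero_apply,
    _root_.zero_apply, ContinuousLinearMap.flip_apply, sub_zero, zero_sub, map_neg, zero_add] at hN'
  rw [map_sub]
  rw [← sub_eq_zero, ← hN']
  abel

/-- A hypercomplex structure in coordinates. -/
theorem isHypercomplexAt_coordEnd (H : HypercomplexStructure n M) (x : M) :
    IsHypercomplexAt (coordEnd H.I x) (coordEnd H.J x) (coordEnd H.K x)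
      (extChartAt 𝓘(ℝ, Model n) x x) where
  smooth_I := contDiffAt_coordEnd H.isComplex_I x
  smooth_J := contDiffAt_coordEnd H.isComplex_J x
  smooth_K := contDiffAt_coordEnd H.isComplex_K x
  triple := by
    refine eventually_extChartAt (Filter.Eventually.of_forall fun q hq => ?_)
    have hinj : Function.Injective (ofCoord x q : Model n → TangentSpace 𝓘(ℝ, Model n) q) :=
      Function.LeftInverse.injective (toCoord_ofCoord hq)
    refine ⟨fun X => hinj ?_, fun X => hinj ?_, fun X => hinj ?_, fun X => hinj ?_⟩
    · rw [ofCoord_coordEnd _ hq, ofCoord_coordEnd _ hq, H.isComplex_I.sq, map_neg]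
    · rw [ofCoord_coordEnd _ hq, ofCoord_coordEnd _ hq, H.isComplex_J.sq, map_neg]
    · rw [ofCoord_coordEnd _ hq, ofCoord_coordEnd _ hq, ofCoord_coordEnd _ hq, H.relIJ]
    · rw [ofCoord_coordEnd _ hq, ofCoord_coordEnd _ hq, map_neg, ofCoord_coordEnd _ hq, ← H.relJI,
        neg_neg]
  nij_I := nijenhuis_coordEnd H.isComplex_I x
  nij_J := nijenhuis_coordEnd H.isComplex_J x
  nij_K := nijenhuis_coordEnd H.isComplex_K x

end ChartEndomorphisms

/-! ## The Dolbeault operators in charts -/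

theorem holPart_compContinuousLinearMap {V W : Type*} [AddCommGroup V] [Module ℝ V]
    [TopologicalSpace V] [AddCommGroup W] [Module ℝ W] [TopologicalSpace W] {I : V →L[ℝ] V}
    {I' : W →L[ℝ] W} {L : W →L[ℝ] V} (h : ∀ v, L (I' v) = I (L v)) {k : ℕ}
    (α : V [⋀^Fin k]→L[ℝ] ℂ) :
    (holPart I α).compContinuousLinearMap L = holPart I' (α.compContinuousLinearMap L) := by
  ext v
  refine (holPartAux_apply I α (L ∘ v)).trans (Eq.trans ?_ (holPartAux_apply I' _ v).symm)
  congr 1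
  refine Finset.sum_congr rfl fun s _ => ?_
  rw [ContinuousAlternatingMap.compContinuousLinearMap_apply]
  congr 2
  ext i
  by_cases hi : i ∈ s <;> simp [hi, h]

section OperatorsInCharts

variable {n : ℕ} {M : Type*} [TopologicalSpace M] [ChartedSpace (Model n) M]
  [IsManifold 𝓘(ℝ, Model n) ∞ M] {x p : M} {k : ℕ}

theorem inChart_holPart (A : EndField n M) (α : Form n M k) (hp : p ∈ (chartAt (Model n) x).source) :
    Form.inChart (fun q => holPart (A q) (α q)) x (extChartAt 𝓘(ℝ, Model n) x p) =
      holPart (coordEnd A x (extChartAt 𝓘(ℝ, Model n) x p))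
        (Form.inChart α x (extChartAt 𝓘(ℝ, Model n) x p)) := by
  rw [inChart_extChartAt _ hp, inChart_extChartAt _ hp]
  exact holPart_compContinuousLinearMap (ofCoord_coordEnd A hp) (α p)

theorem inChart_comp (A : EndField n M) (α : Form n M k) (hp : p ∈ (chartAt (Model n) x).source) :
    Form.inChart (fun q => (α q).compContinuousLinearMap (A q)) x (extChartAt 𝓘(ℝ, Model n) x p) =
      (Form.inChart α x (extChartAt 𝓘(ℝ, Model n) x p)).compContinuousLinearMap
        (coordEnd A x (extChartAt 𝓘(ℝ, Model n) x p)) := by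
  rw [inChart_extChartAt _ hp, inChart_extChartAt _ hp]
  ext v
  simp only [ContinuousAlternatingMap.compContinuousLinearMap_apply]
  congr 1
  ext1 i
  exact (ofCoord_coordEnd A hp (v i)).symm

theorem coordEnd_neg (A : EndField n M) (x : M) (z : Model n) :
    coordEnd (fun q => -A q) x z = -coordEnd A x z := by
  ext1 v
  exact map_neg (toCoord x ((extChartAt 𝓘(ℝ, Model n) x).symm z)) _

theorem ofCoord_self (v : Model n) : (ofCoord x x v : Model n) = v :=
  (toCoord_self (ofCoord x x v)).symm.trans (toCoord_ofCoord (mem_chart_source _ x) v)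

theorem coordEnd_self (A : EndField n M) (x : M) :
    coordEnd A x (extChartAt 𝓘(ℝ, Model n) x x) = (A x : Model n →L[ℝ] Model n) := by
  ext1 v
  have h1 := ofCoord_coordEnd A (mem_chart_source (Model n) x) (x := x) v
  exact ((ofCoord_self _).symm.trans h1).trans (congrArg (A x) (ofCoord_self v))

theorem inChart_self (α : Form n M k) (x : M) :
    Form.inChart α x (extChartAt 𝓘(ℝ, Model n) x x) = (α x : Model n [⋀^Fin k]→L[ℝ] ℂ) := by
  rw [inChart_extChartAt _ (mem_chart_source _ x)]
  ext1 v
  exact congrArg (α x) (funext fun i => ofCoord_self (v i))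

theorem form_d_self (α : Form n M k) (x : M) :
    (Form.d α x : Model n [⋀^Fin (k + 1)]→L[ℝ] ℂ) =
      extDeriv (Form.inChart α x) (extChartAt 𝓘(ℝ, Model n) x x) := by
  rw [form_d_eq]
  ext1 v
  exact congrArg (extDeriv (Form.inChart α x) (extChartAt 𝓘(ℝ, Model n) x x))
    (funext fun i => toCoord_self (v i))

variable (H : HypercomplexStructure n M) {φ : M → ℝ}

theorem inChart_actJ_ofFun (φ : M → ℝ) (x : M) :
    Form.inChart (actJ H (ofFun n φ)) x = fun z =>
      ContinuousAlternatingMap.constOfIsEmpty ℝ (Model n) (Fin 0)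
        (φ ((extChartAt 𝓘(ℝ, Model n) x).symm z) : ℂ) := rfl

/-- The equality is needed on a neighbourhood, and not just at the centre, because ∂ differentiates
it once more. `Form.d` changes chart with the point, hence the recourse to `inChart_d`. -/
theorem inChart_delJ_ofFun (hφ : ContMDiff 𝓘(ℝ, Model n) 𝓘(ℝ, ℝ) ∞ φ) (x : M) :
    Form.inChart (delJ H (ofFun n φ)) x =ᶠ[𝓝 (extChartAt 𝓘(ℝ, Model n) x x)]
      flatDelJ (coordEnd H.I x) (coordEnd H.J x)
        (fun z => φ ((extChartAt 𝓘(ℝ, Model n) x).symm z)) := by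
  have hF := contDiffAt_comp_symm (hφ x)
  have hd : ∀ᶠ z in 𝓝 (extChartAt 𝓘(ℝ, Model n) x x),
      DifferentiableAt ℝ (Form.inChart (actJ H (ofFun n φ)) x) z := by
    filter_upwards [eventually_contDiffAt hF 1] with z hz
    rw [inChart_actJ_ofFun]
    exact (contDiffAt_form fun v =>
      Complex.ofRealCLM.contDiff.contDiffAt.comp z hz).differentiableAt (by simp)
  have hd' := (continuousAt_extChartAt (I := 𝓘(ℝ, Model n)) x).eventually hd
  refine eventually_extChartAt ?_
  filter_upwards [hd'] with q hq hqs
  have h1 := inChart_comp (fun q => -H.J q) (delbar H (actJ H (ofFun n φ))) hqs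
  have h2 := inChart_holPart (fun q => -H.I q) (Form.d (actJ H (ofFun n φ))) hqs
  have h3 := inChart_d (actJ H (ofFun n φ)) hqs hq
  rw [h3, coordEnd_neg] at h2
  refine h1.trans ?_
  rw [coordEnd_neg]
  exact congrArg (fun β : Model n [⋀^Fin 1]→L[ℝ] ℂ => β.compContinuousLinearMap _) h2

theorem inChart_del_delJ_ofFun (hφ : ContMDiff 𝓘(ℝ, Model n) 𝓘(ℝ, ℝ) ∞ φ) (x : M) :
    Form.inChart (del H (delJ H (ofFun n φ))) x =ᶠ[𝓝 (extChartAt 𝓘(ℝ, Model n) x x)]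
      flatHessian (coordEnd H.I x) (coordEnd H.J x)
        (fun z => φ ((extChartAt 𝓘(ℝ, Model n) x).symm z)) := by
  have hF := contDiffAt_comp_symm (hφ x)
  have hd := eventually_contDiffAt (contDiffAt_flatDelJ (contDiffAt_coordEnd H.isComplex_I x)
    (contDiffAt_coordEnd H.isComplex_J x) hF) 1
  have he := (inChart_delJ_ofFun H hφ x).eventuallyEq_nhds
  have hd' := (continuousAt_extChartAt (I := 𝓘(ℝ, Model n)) x).eventually (hd.and he)
  refine eventually_extChartAt ?_
  filter_upwards [hd'] with q hq hqs
  have h2 := inChart_holPart H.I (Form.d (delJ H (ofFun n φ))) hqs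
  rw [inChart_d _ hqs ((hq.1.differentiableAt (by simp)).congr_of_eventuallyEq hq.2),
    hq.2.extDeriv_eq] at h2
  exact h2

end OperatorsInCharts

/-! ## The metric of a q-real form field -/

section FlatMetric

variable {E : Type*} [NormedAddCommGroup E] [NormedSpace ℝ E] [FiniteDimensional ℝ E]
  {G : Type*} [NormedAddCommGroup G] [NormedSpace ℝ G] {m : WithTop ℕ∞}

theorem contDiffAt_clm {F : Type*} [NormedAddCommGroup F] [NormedSpace ℝ F] {f : G → E →L[ℝ] F}
    {x : G} (h : ∀ v, ContDiffAt ℝ m (fun y => f y v) x) : ContDiffAt ℝ m f x := by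
  let d := Module.finrank ℝ E
  have hd : d = Module.finrank ℝ (Fin d → ℝ) := Module.finrank_fin_fun ℝ |>.symm
  let e₁ := ContinuousLinearEquiv.ofFinrankEq hd
  let e₂ := (e₁.arrowCongr (1 : F ≃L[ℝ] F)).trans (ContinuousLinearEquiv.piRing (Fin d))
  rw [← Function.id_comp f, ← e₂.symm_comp_self]
  exact e₂.symm.contDiff.contDiffAt.comp x (contDiffAt_pi.mpr fun i => h _)

theorem contDiffAt_metricOf {L : G → E →L[ℝ] E} {w : G → E [⋀^Fin 2]→L[ℝ] ℂ} {x : G}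
    (hL : ContDiffAt ℝ m L x) (hw : ContDiffAt ℝ m w x) :
    ContDiffAt ℝ m (fun y => metricOf (L y) (w y)) x := by
  refine contDiffAt_clm fun u => contDiffAt_clm fun v => ?_
  refine Complex.reCLM.contDiff.contDiffAt.comp x
    (contDiffAt_form_apply (v := fun y => ![u, L y v]) hw fun i => ?_)
  fin_cases i
  · exact contDiffAt_const
  · exact hL.clm_apply contDiffAt_const

theorem metricOf_add (J : E →L[ℝ] E) (η ζ : E [⋀^Fin 2]→L[ℝ] ℂ) (X Y : E) :
    metricOf J (η + ζ) X Y = metricOf J η X Y + metricOf J ζ X Y := by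
  simp only [metricOf_apply, ContinuousAlternatingMap.add_apply, Complex.add_re]

/-- Positive definiteness is an open condition. -/
theorem eventually_posDef {T : Type*} [TopologicalSpace T] {B : T → E →L[ℝ] E →L[ℝ] ℝ} {t : T}
    (hB : ContinuousAt B t) (hpos : ∀ X, X ≠ 0 → 0 < B t X X) :
    ∀ᶠ s in 𝓝 t, ∀ X, X ≠ 0 → 0 < B s X X := by
  obtain ⟨c, hc, hcX⟩ := exists_pos_mul_sq_le_bilin _ hpos
  have hball : Metric.ball (B t) c ∈ 𝓝 (B t) := Metric.ball_mem_nhds (B t) hc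
  filter_upwards [hB hball] with s hs X hX
  have h1 : ‖(B s - B t) X X‖ ≤ ‖B s - B t‖ * ‖X‖ * ‖X‖ := (B s - B t).le_opNorm₂ X X
  have h2 : ‖B s - B t‖ < c := (dist_eq_norm (B s) (B t)).symm.trans_lt hs
  have hX' : 0 < ‖X‖ := norm_pos_iff.mpr hX
  have h3 : ‖B s - B t‖ * ‖X‖ * ‖X‖ < c * ‖X‖ * ‖X‖ := by gcongr
  have h4 := (abs_le.mp h1).1
  simp only [_root_.sub_apply] at h4
  have h5 := hcX X
  nlinarith

end FlatMetric

/-! ### The Riemannian metric of a positive form on the manifold. -/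

section FieldMetric

variable {n : ℕ} {M : Type*} [TopologicalSpace M] [ChartedSpace (Model n) M]

instance (x : M) : FiniteDimensional ℝ (TangentSpace 𝓘(ℝ, Model n) x) :=
  inferInstanceAs (FiniteDimensional ℝ (Model n))

instance (x : M) : T2Space (TangentSpace 𝓘(ℝ, Model n) x) :=
  inferInstanceAs (T2Space (Model n))

theorem finrank_tangentSpace (x : M) :
    Module.finrank ℝ (TangentSpace 𝓘(ℝ, Model n) x) = 4 * n :=
  (finrank_euclideanSpace_fin : Module.finrank ℝ (Model n) = 4 * n)

/-- A form is smooth at `x` if it is so in the chart around `x`. -/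
def Form.SmoothAt {k : ℕ} (α : Form n M k) (x : M) : Prop :=
  ContDiffAt ℝ ∞ (Form.inChart α x) (extChartAt 𝓘(ℝ, Model n) x x)

theorem Form.SmoothAt.add {k : ℕ} {α β : Form n M k} {x : M} (hα : α.SmoothAt x) (hβ : β.SmoothAt x) :
    (α + β).SmoothAt x :=
  ContDiffAt.add hα hβ

variable [IsManifold 𝓘(ℝ, Model n) ∞ M]

/-- The metric of a two-form in the chart around `x`. -/
noncomputable def coordMetric (A : EndField n M) (α : Form n M 2) (x p : M) :
    Model n →L[ℝ] Model n →L[ℝ] ℝ :=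
  metricOf (coordEnd A x (extChartAt 𝓘(ℝ, Model n) x p))
    (Form.inChart α x (extChartAt 𝓘(ℝ, Model n) x p))

variable {A : EndField n M} {α : Form n M 2} {x p : M}

theorem coordMetric_apply (hp : p ∈ (chartAt (Model n) x).source) (u v : Model n) :
    coordMetric A α x p u v = metricOf (A p) (α p) (ofCoord x p u) (ofCoord x p v) := by
  rw [metricOf_apply, coordMetric, metricOf_apply, inChart_extChartAt _ hp,
    ContinuousAlternatingMap.compContinuousLinearMap_apply, ← ofCoord_coordEnd A hp]
  congr 2
  ext1 i
  fin_cases i <;> rfl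

theorem contMDiffAt_coordMetric (hA : IsComplexStructure A) (hα : α.SmoothAt x) :
    ContMDiffAt 𝓘(ℝ, Model n) 𝓘(ℝ, Model n →L[ℝ] Model n →L[ℝ] ℝ) ∞ (coordMetric A α x) x :=
  (contDiffAt_metricOf (contDiffAt_coordEnd hA x) hα).contMDiffAt.comp x contMDiffAt_extChartAt

theorem posDef_coordMetric_iff (hp : p ∈ (chartAt (Model n) x).source) :
    (∀ u, u ≠ 0 → 0 < coordMetric A α x p u u) ↔
      ∀ X : TangentSpace 𝓘(ℝ, Model n) p, X ≠ 0 → 0 < metricOf (A p) (α p) X X := by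
  constructor
  · intro h X hX
    have h1 : toCoord x p X ≠ 0 := by
      intro h0
      apply hX
      rw [← ofCoord_toCoord hp X, h0, map_zero]
    have h2 := h _ h1
    rwa [coordMetric_apply hp, ofCoord_toCoord hp] at h2
  · intro h u hu
    rw [coordMetric_apply hp]
    refine h _ fun h0 => hu ?_
    rw [← toCoord_ofCoord hp u, h0, map_zero]

theorem isOpen_posDef (hA : IsComplexStructure A) (hα : ∀ x, α.SmoothAt x) :
    IsOpen {p : M | ∀ X : TangentSpace 𝓘(ℝ, Model n) p, X ≠ 0 → 0 < metricOf (A p) (α p) X X} := by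
  rw [isOpen_iff_mem_nhds]
  intro x hx
  have h1 := (posDef_coordMetric_iff (mem_chart_source (Model n) x)).mpr hx
  filter_upwards [eventually_posDef (contMDiffAt_coordMetric hA (hα x)).continuousAt h1,
    (chartAt (Model n) x).open_source.mem_nhds (mem_chart_source _ x)] with p hp hps
  exact (posDef_coordMetric_iff hps).mp hp

/-- A negative value on a vector would persist at nearby points on the vector with the same
coordinates, contradicting definiteness at a point of the set. -/
theorem posSemidef_of_mem_closure (hA : IsComplexStructure A) (hα : α.SmoothAt x)
    (hx : x ∈ closure {p : M | ∀ X : TangentSpace 𝓘(ℝ, Model n) p, X ≠ 0 →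
      0 < metricOf (A p) (α p) X X}) (X : TangentSpace 𝓘(ℝ, Model n) x) :
    0 ≤ metricOf (A x) (α x) X X := by
  have hxs := mem_chart_source (Model n) x
  rw [← ofCoord_toCoord hxs X, ← coordMetric_apply hxs]
  set u := toCoord x x X
  rcases eq_or_ne u 0 with hu | hu
  · simp [hu]
  have h1 : ContinuousAt (fun p => coordMetric A α x p u u) x := by
    have := (contMDiffAt_coordMetric hA hα).continuousAt
    fun_prop
  by_contra! hneg
  have h2 := h1.eventually (Iio_mem_nhds hneg)
  obtain ⟨p, ⟨hp1, hp2⟩, hp3⟩ := mem_closure_iff_nhds.mp hx _ (Filter.inter_mem h2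
    ((chartAt (Model n) x).open_source.mem_nhds hxs))
  exact lt_asymm hp1 ((posDef_coordMetric_iff hp2).mpr hp3 u hu)

/-- The Riemannian metric of a positive two-form. -/
noncomputable def metricOfForm (hA : IsComplexStructure A) (hα : ∀ x, α.SmoothAt x)
    (hsymm : ∀ x X Y, metricOf (A x) (α x) X Y = metricOf (A x) (α x) Y X)
    (hpos : ∀ x X, X ≠ 0 → 0 < metricOf (A x) (α x) X X) : Metric n M where
  inner x := metricOf (A x) (α x)
  symm := hsymm
  pos := hpos
  isVonNBounded x := by
    obtain ⟨c, hc, hcX⟩ := exists_pos_mul_sq_le_bilin (V := Model n) (metricOf (A x) (α x)) (hpos x)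
    -- From ‖X‖² < c⁻¹ and 2‖X‖ ≤ ‖X‖² + 1 one gets the bound c⁻¹ + 1 without a square root.
    refine (NormedSpace.isVonNBounded_iff' (𝕜 := ℝ) (E := Model n)).mpr ⟨c⁻¹ + 1, fun X hX => ?_⟩
    have h1 : c * ‖X‖ ^ 2 < 1 := (hcX X).trans_lt hX
    have h2 : ‖X‖ ^ 2 < c⁻¹ := by rwa [← one_div, lt_div_iff₀' hc]
    nlinarith [sq_nonneg (‖X‖ - 1), inv_pos.mpr hc]
  contMDiff x := by
    refine (contMDiffAt_hom_bundle _).mpr ⟨contMDiffAt_id, ?_⟩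
    refine (contMDiffAt_coordMetric hA (hα x)).congr_of_eventuallyEq ?_
    filter_upwards [(chartAt (Model n) x).open_source.mem_nhds (mem_chart_source _ x)] with p hp
    ext u v
    rw [coordMetric_apply hp]
    have hp' : p ∈ (trivializationAt (Model n) (TangentSpace 𝓘(ℝ, Model n)) x).baseSet := by
      simpa using hp
    refine (inCoordinates_apply_eq₂ (𝕜 := ℝ) (F₃ := ℝ) (E₃ := Bundle.Trivial M ℝ)
      (ϕ := metricOf (A p) (α p)) (v := u) (w := v) hp' hp' (Set.mem_univ _)).trans ?_
    have hu : ∀ w : Model n, (trivializationAt (Model n) (TangentSpace 𝓘(ℝ, Model n)) x).symm p w =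
        ofCoord x p w := fun w => (Bundle.Trivialization.symmL_apply _ hp' w).symm
    rw [hu, hu]
    simp

end FieldMetric

/-! ## Solutions of the quaternionic Monge-Ampère equation -/

section MongeAmpere

variable {n : ℕ} {M : Type*} [TopologicalSpace M] [ChartedSpace (Model n) M]
  [IsManifold 𝓘(ℝ, Model n) ∞ M] (H : HypercomplexStructure n M) {Ω : Form n M 2} {g : Metric n M}
  {φ : M → ℝ} {x : M}

theorem HypercomplexStructure.isQuatTriple (x : M) : IsQuatTriple (H.I x) (H.J x) (H.K x) where
  II := H.isComplex_I.sq x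
  JJ := H.isComplex_J.sq x
  JI := H.relIJ x
  IJ X := neg_eq_iff_eq_neg.mp (H.relJI x X)

variable {H}

theorem IsQuaternionicHermitian.isHermitianForm (hg : IsQuaternionicHermitian H g) (x : M) :
    IsHermitianForm (H.I x) (H.J x) (H.K x) (g.inner x) where
  symm := g.symm x
  inv_I X Y := by simpa using hg 0 1 0 0 (by norm_num) x X Y
  inv_J X Y := by simpa using hg 0 0 1 0 (by norm_num) x X Y
  inv_K X Y := by simpa using hg 0 0 0 1 (by norm_num) x X Y

/-- On fields with constant coordinates the values of `Ω` are expressed through `g`, `J` and `K`,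
all smooth. -/
theorem IsFormOfMetric.smoothAt (hΩ : IsFormOfMetric H g Ω) (x : M) : Ω.SmoothAt x := by
  refine contDiffAt_form fun v => ?_
  have hX := contMDiffAt_ofCoord x (v 0)
  have hY := contMDiffAt_ofCoord x (v 1)
  have h1 := contMDiffAt_metric g hX (contMDiffAt_app H.isComplex_J hY)
  have h2 := contMDiffAt_metric g hX (contMDiffAt_app H.isComplex_K hY)
  have hs : ∀ F : M → ℝ, ContMDiffAt 𝓘(ℝ, Model n) 𝓘(ℝ, ℝ) ∞ F x →
      ContDiffAt ℝ ∞ (fun z => (F ((extChartAt 𝓘(ℝ, Model n) x).symm z) : ℂ))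
        (extChartAt 𝓘(ℝ, Model n) x x) := fun F hF =>
    Complex.ofRealCLM.contDiff.contDiffAt.comp _ (contDiffAt_comp_symm hF)
  have h4 := (hs _ h1).neg.add (contDiffAt_const (c := Complex.I) |>.mul (hs _ h2))
  refine h4.congr_of_eventuallyEq
    (eventually_extChartAt (Filter.Eventually.of_forall fun q hq => ?_))
  have h3 : (extChartAt 𝓘(ℝ, Model n) x).symm (extChartAt 𝓘(ℝ, Model n) x q) = q :=
    (extChartAt 𝓘(ℝ, Model n) x).left_inv (by simpa using hq)
  have hv : (ofCoord x q ∘ v : Fin 2 → TangentSpace 𝓘(ℝ, Model n) q) =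
      ![ofCoord x q (v 0), ofCoord x q (v 1)] := by
    ext1 i
    fin_cases i <;> rfl
  beta_reduce
  rw [inChart_extChartAt _ hq, ContinuousAlternatingMap.compContinuousLinearMap_apply, hv, hΩ]
  generalize (extChartAt 𝓘(ℝ, Model n) x).symm (extChartAt 𝓘(ℝ, Model n) x q) = r at h3
  subst h3
  rfl

theorem IsFormOfMetric.mem_qReal20 (hg : IsQuaternionicHermitian H g) (hΩ : IsFormOfMetric H g Ω)
    (x : M) : Ω x ∈ qReal20 (H.I x) (H.J x) :=
  IsFormOf.mem_qReal20 (H.isQuatTriple x) (hg.isHermitianForm x) (hΩ x)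

theorem del_delJ_self (hφ : ContMDiff 𝓘(ℝ, Model n) 𝓘(ℝ, ℝ) ∞ φ) (x : M) :
    (del H (delJ H (ofFun n φ)) x : Model n [⋀^Fin 2]→L[ℝ] ℂ) =
      flatHessian (coordEnd H.I x) (coordEnd H.J x)
        (fun z => φ ((extChartAt 𝓘(ℝ, Model n) x).symm z)) (extChartAt 𝓘(ℝ, Model n) x x) :=
  (inChart_self _ x).symm.trans (inChart_del_delJ_ofFun H hφ x).self_of_nhds

theorem smoothAt_del_delJ (hφ : ContMDiff 𝓘(ℝ, Model n) 𝓘(ℝ, ℝ) ∞ φ) (x : M) :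
    (del H (delJ H (ofFun n φ))).SmoothAt x :=
  (contDiffAt_flatHessian (contDiffAt_coordEnd H.isComplex_I x)
    (contDiffAt_coordEnd H.isComplex_J x) (contDiffAt_comp_symm (hφ x))).congr_of_eventuallyEq
    (inChart_del_delJ_ofFun H hφ x)

theorem del_delJ_mem_qReal20 (hφ : ContMDiff 𝓘(ℝ, Model n) 𝓘(ℝ, ℝ) ∞ φ) (x : M) :
    del H (delJ H (ofFun n φ)) x ∈ qReal20 (H.I x) (H.J x) := by
  have h1 := flatHessian_mem_qReal20 (isHypercomplexAt_coordEnd H x) (contDiffAt_comp_symm (hφ x))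
  rw [← del_delJ_self hφ x, coordEnd_self, coordEnd_self] at h1
  exact h1

theorem del_eq_zero_iff {k : ℕ} {α : Form n M k} : del H α x = 0 ↔
    holPart (coordEnd H.I x (extChartAt 𝓘(ℝ, Model n) x x))
      (extDeriv (Form.inChart α x) (extChartAt 𝓘(ℝ, Model n) x x)) = 0 := by
  rw [coordEnd_self, ← form_d_self]
  rfl

theorem del_add_eq_zero {k : ℕ} {α β : Form n M k} (hα : α.SmoothAt x) (hβ : β.SmoothAt x)
    (hα0 : del H α x = 0) (hβ0 : del H β x = 0) : del H (α + β) x = 0 := by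
  rw [del_eq_zero_iff] at *
  have h1 : extDeriv (Form.inChart (α + β) x) (extChartAt 𝓘(ℝ, Model n) x x) =
      extDeriv (Form.inChart α x) (extChartAt 𝓘(ℝ, Model n) x x) +
        extDeriv (Form.inChart β x) (extChartAt 𝓘(ℝ, Model n) x x) :=
    extDeriv_add (hα.differentiableAt (by simp)) (hβ.differentiableAt (by simp))
  rw [h1, holPart_add, hα0, hβ0, add_zero]

theorem del_del_delJ (hφ : ContMDiff 𝓘(ℝ, Model n) 𝓘(ℝ, ℝ) ∞ φ) (x : M) :
    del H (del H (delJ H (ofFun n φ))) x = 0 := by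
  rw [del_eq_zero_iff, (inChart_del_delJ_ofFun H hφ x).extDeriv_eq]
  exact holPart_extDeriv_flatHessian (isHypercomplexAt_coordEnd H x) (contDiffAt_comp_symm (hφ x))

/-- At a local minimum of `φ` the form `∂∂_J φ` is positive semidefinite. -/
theorem metricOf_del_delJ_nonneg (hφ : ContMDiff 𝓘(ℝ, Model n) 𝓘(ℝ, ℝ) ∞ φ)
    (hmin : IsLocalMin φ x) (X : TangentSpace 𝓘(ℝ, Model n) x) :
    0 ≤ metricOf (H.J x) (del H (delJ H (ofFun n φ)) x) X X := by
  have hF := contDiffAt_comp_symm (hφ x)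
  have hmin' : IsLocalMin (fun z => φ ((extChartAt 𝓘(ℝ, Model n) x).symm z))
      (extChartAt 𝓘(ℝ, Model n) x x) := by
    refine eventually_extChartAt ?_
    filter_upwards [hmin] with q hq hqs
    have h3 : (extChartAt 𝓘(ℝ, Model n) x).symm (extChartAt 𝓘(ℝ, Model n) x q) = q :=
      (extChartAt 𝓘(ℝ, Model n) x).left_inv (by simpa using hqs)
    rwa [h3, extChartAt_to_inv]
  have h1 : ∀ Y : Model n, 0 ≤ metricOf (coordEnd H.J x (extChartAt 𝓘(ℝ, Model n) x x))
      (flatHessian (coordEnd H.I x) (coordEnd H.J x)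
        (fun z => φ ((extChartAt 𝓘(ℝ, Model n) x).symm z)) (extChartAt 𝓘(ℝ, Model n) x x)) Y Y := by
    intro Y
    rw [metricOf_flatHessian_of_critical (isHypercomplexAt_coordEnd H x) hF hmin'.fderiv_eq_zero]
    have := second_deriv_nonneg hF hmin'
    have h4 := this Y
    have h5 := this (coordEnd H.I x (extChartAt 𝓘(ℝ, Model n) x x) Y)
    have h6 := this (coordEnd H.J x (extChartAt 𝓘(ℝ, Model n) x x) Y)
    have h7 := this (coordEnd H.K x (extChartAt 𝓘(ℝ, Model n) x x) Y)
    positivity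
  rw [← del_delJ_self hφ x, coordEnd_self] at h1
  exact h1 X

/-- A closed and open condition which holds at the local minima of a continuous function holds
everywhere on a compact space. -/
theorem eq_univ_of_isClopen_of_isLocalMin {T : Type*} [TopologicalSpace T] [CompactSpace T]
    {φ : T → ℝ} (hφ : Continuous φ) {U : Set T} (hU : IsClopen U)
    (hmin : ∀ x, IsLocalMin φ x → x ∈ U) : U = Set.univ := by
  by_contra hne
  have hne' : Uᶜ.Nonempty := Set.nonempty_compl.mpr hne
  -- The complement is closed, hence compact, so a minimum exists; it is open, so this minimum is a
  -- local one in the whole space.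
  obtain ⟨x, hx, hxmin⟩ := (hU.compl.1.isCompact).exists_isMinOn hne' hφ.continuousOn
  exact hx (hmin x (hxmin.isLocalMin (hU.compl.2.mem_nhds hx)))

variable {f : M → ℝ}

/-- This is the continuity argument, and the place where compactness and the Monge-Ampère equation
enter. -/
theorem metricOf_add_del_delJ_pos [CompactSpace M] (hg : IsQuaternionicHermitian H g)
    (hΩ : IsFormOfMetric H g Ω) (hφ : ContMDiff 𝓘(ℝ, Model n) 𝓘(ℝ, ℝ) ∞ φ)
    (hMA : ∀ x : M, wedgePow ((Ω + del H (delJ H (ofFun n φ))) x).toAlternatingMap n =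
      (Real.exp (f x)) • wedgePow (Ω x).toAlternatingMap n) (x : M)
    (X : TangentSpace 𝓘(ℝ, Model n) x) (hX : X ≠ 0) :
    0 < metricOf (H.J x) ((Ω + del H (delJ H (ofFun n φ))) x) X X := by
  set α := Ω + del H (delJ H (ofFun n φ)) with hα
  have hαs : ∀ x, α.SmoothAt x := fun x => (hΩ.smoothAt x).add (smoothAt_del_delJ hφ x)
  have hαq : ∀ x, α x ∈ qReal20 (H.I x) (H.J x) := fun x =>
    add_mem (hΩ.mem_qReal20 hg x) (del_delJ_mem_qReal20 hφ x)
  set U := {p : M | ∀ X : TangentSpace 𝓘(ℝ, Model n) p, X ≠ 0 → 0 < metricOf (H.J p) (α p) X X}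
    with hUdef
  suffices h : U = Set.univ from (h ▸ Set.mem_univ x : x ∈ U) X hX
  refine eq_univ_of_isClopen_of_isLocalMin hφ.continuous ⟨?_, ?_⟩ ?_
  -- At a limit point the form is semidefinite; a null vector is then in its kernel, which the
  -- Monge-Ampère equation makes trivial.
  · refine isClosed_of_closure_subset fun p hp Y hY => ?_
    have hpos := posSemidef_of_mem_closure H.isComplex_J (hαs p) hp
    refine lt_of_le_of_ne (hpos Y) fun h0 => hY ?_
    exact eq_zero_of_mem_kernel (H.isQuatTriple p) (hg.isHermitianForm p) (g.pos p)
      (finrank_tangentSpace p) (hΩ p) (Real.exp_ne_zero _) (hMA p)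
      (kernel_of_null (H.isQuatTriple p) (hαq p) hpos h0.symm)
  · exact isOpen_posDef H.isComplex_J hαs
  · intro p hp Y hY
    have h1 : metricOf (H.J p) (Ω p) Y Y = g.inner p Y Y := by
      rw [metricOf_apply, IsFormOf.apply_J (H.isQuatTriple p) (hg.isHermitianForm p) (hΩ p),
        Complex.ofReal_re]
    have h2 : metricOf (H.J p) (α p) Y Y = metricOf (H.J p) (Ω p) Y Y +
        metricOf (H.J p) (del H (delJ H (ofFun n φ)) p) Y Y :=
      metricOf_add (E := Model n) _ _ _ _ _
    rw [h2, h1]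
    exact add_pos_of_pos_of_nonneg (g.pos p Y hY) (metricOf_del_delJ_nonneg hφ hp Y)

end MongeAmpere

end HKT

theorem mainTheorem10 (n : ℕ) {M : Type*} [TopologicalSpace M] [T2Space M] [CompactSpace M]
    [ChartedSpace (HKT.Model n) M] [IsManifold 𝓘(ℝ, HKT.Model n) ∞ M]
    (H : HKT.HypercomplexStructure n M) (Ω : HKT.Form n M 2) (hΩ : HKT.IsHKTForm H Ω)
    (f φ : M → ℝ) (hf : ContMDiff 𝓘(ℝ, HKT.Model n) 𝓘(ℝ, ℝ) ∞ f)
    (hφ : ContMDiff 𝓘(ℝ, HKT.Model n) 𝓘(ℝ, ℝ) ∞ φ)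
    (hMA : ∀ x : M,
      HKT.wedgePow ((Ω + HKT.del H (HKT.delJ H (HKT.ofFun n φ))) x).toAlternatingMap n =
        (Real.exp (f x)) • HKT.wedgePow (Ω x).toAlternatingMap n) :
    (∀ x : M, (Ω + HKT.del H (HKT.delJ H (HKT.ofFun n φ))) x ∈
      ((↑) : HKT.qReal20 (H.I x) (H.J x) → _) '' interior (HKT.qPositiveCone (H.I x) (H.J x))) ∧
    HKT.IsHKTForm H (Ω + HKT.del H (HKT.delJ H (HKT.ofFun n φ))) := by
  obtain ⟨⟨g, hg, hgΩ⟩, hdΩ⟩ := hΩ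
  have hpos := HKT.metricOf_add_del_delJ_pos hg hgΩ hφ hMA
  have hs : ∀ x, (Ω + HKT.del H (HKT.delJ H (HKT.ofFun n φ))).SmoothAt x := fun x =>
    (hgΩ.smoothAt x).add (HKT.smoothAt_del_delJ hφ x)
  have hq : ∀ x, (Ω + HKT.del H (HKT.delJ H (HKT.ofFun n φ))) x ∈ HKT.qReal20 (H.I x) (H.J x) :=
    fun x => add_mem (hgΩ.mem_qReal20 hg x) (HKT.del_delJ_mem_qReal20 hφ x)
  have hherm := fun x => HKT.isHermitianForm_metricOf (H.isQuatTriple x) (hq x)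
  refine ⟨fun x => ⟨⟨_, hq x⟩, ?_, rfl⟩, ⟨HKT.metricOfForm H.isComplex_J hs
    (fun x => (hherm x).symm) hpos, ?_, ?_⟩, ?_⟩
  -- The tangent space is the model space by definition; the Euclidean norm of the latter is the one
  -- in which the ball around the form is taken.
  · exact HKT.mem_interior_qPositiveCone (V := HKT.Model n) (H.isQuatTriple x) ⟨_, hq x⟩ (hpos x)
  · intro a b c d hn x X Y
    exact (hherm x).unit_quaternion (H.isQuatTriple x) hn X Y
  · intro x
    exact HKT.isFormOf_metricOf (H.isQuatTriple x) (hq x)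
  · funext x
    exact HKT.del_add_eq_zero (hgΩ.smoothAt x) (HKT.smoothAt_del_delJ hφ x) (congrFun hdΩ x)
      (HKT.del_del_delJ hφ x)
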